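/- Work with two-sorted structures $M=(\mathbb N_M,\mathcal S_M,0,1,+,\cdot,<)$ for the language of second-order arithmetic (number variables range over $\mathbb N_M$, set variables over a nonempty family $\mathcal S_M$ of subsets of $\mathbb N_M$). $\mathsf{RCA}_0$ consists of the axioms of discretely ordered commutative semirings with identity, $\Sigma^0_1$ induction and $\Delta^0_1$ comprehension; $\mathsf{ACA}_0$ consists of the same semiring axioms, the induction axiom for sets, and comprehension for all arithmetical formulas (in all schemes, number and set parameters are allowed). In $\mathsf{RCA}_0$ (so that all numbers, sets and functions below are those of $M$) define the following. A quasi-order $Q$ is a set with a reflexive and transitive relation $\le_Q$ on it (also a set). $Q$ is a wqo if for every function $f\colon\mathbb N\to Q$ there are $m<n$ with $f(m)\le_Q f(n)$. $\mathcal P_{\mathrm f}(Q)$ is the set of (codes of) finite subsets of $Q$, and $\mathcal P_{\mathrm f}^\sharp(Q)$ is $\mathcal P_{\mathrm f}(Q)$ with the quasi-order $A\le_Q^\sharp B\iff(\forall b\in B)(\exists a\in A)(a\le_Q b)$. For a quasi-order $P$, the space $\mathrm{upper}(P)$ has the set of points $P$ and the basic open sets $V_i=\{x\in P:(\forall e\in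 i)(x\not\le_P e)\}$ for $i\in\mathcal P_{\mathrm f}(P)$. A function $h\colon\mathbb N\to\mathcal P_{\mathrm f}(\mathcal P_{\mathrm f}(P))$ codes the effectively open set $G_h=\bigcup_{n\in\mathbb N}\bigcup_{i\in h(n)}V_i$ (membership in $G_h$ being understood as the defining formula). $\mathrm{upper}(P)$ is Noetherian if every effectively open set is compact, that is, if for all such $h,f$ with $G_h\subseteq G_f$ there is an $N\in\mathbb N$ with $G_h\subseteq\bigcup_{n<N}\bigcup_{i\in f(n)}V_i$. **Theorem.** The statement "for every quasi-order $Q$, if $Q$ is a wqo, then $\mathrm{upper}(\mathcal P_{\mathrm f}^\sharp(Q))$ is Noetherian" implies $\mathsf{ACA}_0$ over $\mathsf{RCA}_0$. That is, every model of $\mathsf{RCA}_0$ in which this statement is true is a model of $\mathsf{ACA}_0$. -/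

import Mathlib

universe u

/-- A structure for the (two-sorted) language of second-order arithmetic: a domain `Num` for the
first-order variables with the arithmetical operations, and a nonempty collection `sets` of subsets
of `Num` over which the second-order variables range. Neither sort need be standard. -/
structure L2Structure where
  Num : Type u
  zero : Num
  one : Num
  add : Num → Num → Num
  mul : Num → Num → Num
  lt : Num → Num → Prop
  sets : Set (Set Num)
  sets_nonempty : sets.Nonempty

namespace L2Structure

instance (M : L2Structure.{u}) : Zero M.Num := ⟨M.zero⟩
instance (M : L2Structure.{u}) : One M.Num := ⟨M.one⟩
instance (M : L2Structure.{u}) : Add M.Num := ⟨M.add⟩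
instance (M : L2Structure.{u}) : Mul M.Num := ⟨M.mul⟩
instance (M : L2Structure.{u}) : LT M.Num := ⟨M.lt⟩

end L2Structure

/-! ### Arithmetical formulas -/

/-- Numerical terms; `var k` is the `k`-th number variable (de Bruijn style). -/
inductive ArithTerm where
  | var (k : ℕ)
  | zero
  | one
  | add (s t : ArithTerm)
  | mul (s t : ArithTerm)

/-- Arithmetical formulas, that is, formulas of second-order arithmetic without set quantifiers;
free set variables (`mem t k` says that `t` belongs to the `k`-th set variable) are allowed.
A quantifier binds the variable `var 0` of its body and shifts the other variables by one.
`ball t φ` and `bex t φ` are the bounded quantifiers `∀ x < t, φ` and `∃ x < t, φ`; the bound `t`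
lives outside the scope of the quantifier. -/
inductive ArithFormula where
  | eq (s t : ArithTerm)
  | lt (s t : ArithTerm)
  | mem (t : ArithTerm) (k : ℕ)
  | neg (φ : ArithFormula)
  | and (φ ψ : ArithFormula)
  | or (φ ψ : ArithFormula)
  | imp (φ ψ : ArithFormula)
  | ball (t : ArithTerm) (φ : ArithFormula)
  | bex (t : ArithTerm) (φ : ArithFormula)
  | all (φ : ArithFormula)
  | ex (φ : ArithFormula)

namespace ArithFormula

/-- All quantifiers of the formula are bounded (`Σ⁰₀` formulas). -/
def IsBounded : ArithFormula → Prop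
  | eq _ _ => True
  | lt _ _ => True
  | mem _ _ => True
  | neg φ => φ.IsBounded
  | and φ ψ => φ.IsBounded ∧ ψ.IsBounded
  | or φ ψ => φ.IsBounded ∧ ψ.IsBounded
  | imp φ ψ => φ.IsBounded ∧ ψ.IsBounded
  | ball _ φ => φ.IsBounded
  | bex _ φ => φ.IsBounded
  | all _ => False
  | ex _ => False

/-- `Σ⁰₁` formulas: `∃ x, θ` with `θ` bounded. -/
def IsSigma1 (φ : ArithFormula) : Prop := ∃ θ : ArithFormula, θ.IsBounded ∧ φ = ex θ

/-- `Π⁰₁` formulas: `∀ x, θ` with `θ` bounded. -/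
def IsPi1 (φ : ArithFormula) : Prop := ∃ θ : ArithFormula, θ.IsBounded ∧ φ = all θ

end ArithFormula

namespace L2Structure

variable (M : L2Structure.{u})

/-- The assignment that gives `a` to variable `0` and `v k` to variable `k + 1`. -/
def push (a : M.Num) (v : ℕ → M.Num) : ℕ → M.Num
  | 0 => a
  | k + 1 => v k

/-- The value of a term under an assignment. -/
def termVal (v : ℕ → M.Num) : ArithTerm → M.Num
  | .var k => v k
  | .zero => 0
  | .one => 1
  | .add s t => termVal v s + termVal v t
  | .mul s t => termVal v s * termVal v t

/-- Truth of an arithmetical formula in `M`, where `v` and `V` assign values to the number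
variables and to the set variables. -/
def Sat (V : ℕ → M.sets) : (ℕ → M.Num) → ArithFormula → Prop
  | v, .eq s t => M.termVal v s = M.termVal v t
  | v, .lt s t => M.termVal v s < M.termVal v t
  | v, .mem t k => M.termVal v t ∈ (V k : Set M.Num)
  | v, .neg φ => ¬ Sat V v φ
  | v, .and φ ψ => Sat V v φ ∧ Sat V v ψ
  | v, .or φ ψ => Sat V v φ ∨ Sat V v ψ
  | v, .imp φ ψ => Sat V v φ → Sat V v ψ
  | v, .ball t φ => ∀ a : M.Num, a < M.termVal v t → Sat V (M.push a v) φ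
  | v, .bex t φ => ∃ a : M.Num, a < M.termVal v t ∧ Sat V (M.push a v) φ
  | v, .all φ => ∀ a : M.Num, Sat V (M.push a v) φ
  | v, .ex φ => ∃ a : M.Num, Sat V (M.push a v) φ

/-! ### The axiom systems -/

/-- The number sort is (the nonnegative part of) a discretely ordered commutative semiring with
identity: the usual axioms of `PA⁻`. -/
structure IsDiscretelyOrderedSemiring : Prop where
  add_assoc : ∀ a b c : M.Num, a + b + c = a + (b + c)
  add_comm : ∀ a b : M.Num, a + b = b + a
  add_zero : ∀ a : M.Num, a + 0 = a
  mul_assoc : ∀ a b c : M.Num, a * b * c = a * (b * c)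
  mul_comm : ∀ a b : M.Num, a * b = b * a
  mul_one : ∀ a : M.Num, a * 1 = a
  mul_zero : ∀ a : M.Num, a * 0 = 0
  mul_add : ∀ a b c : M.Num, a * (b + c) = a * b + a * c
  lt_irrefl : ∀ a : M.Num, ¬ a < a
  lt_trans : ∀ a b c : M.Num, a < b → b < c → a < c
  lt_total : ∀ a b : M.Num, a < b ∨ a = b ∨ b < a
  add_lt_add : ∀ a b c : M.Num, a < b → a + c < b + c
  mul_lt_mul : ∀ a b c : M.Num, 0 < c → a < b → a * c < b * c
  exists_add_of_lt : ∀ a b : M.Num, a < b → ∃ c, a + c = b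
  zero_lt_one : (0 : M.Num) < 1
  nonneg : ∀ a : M.Num, a = 0 ∨ 0 < a
  discrete : ∀ a : M.Num, 0 < a → a = 1 ∨ 1 < a

/-- `M` is a model of `RCA₀`: basic axioms, `Σ⁰₁` induction and `Δ⁰₁` comprehension, both with
arbitrary number and set parameters (given by the assignments `v` and `V`). -/
structure ModelsRCA0 : Prop where
  basic : M.IsDiscretelyOrderedSemiring
  sigma1_induction : ∀ φ : ArithFormula, φ.IsSigma1 → ∀ (V : ℕ → M.sets) (v : ℕ → M.Num),
    M.Sat V (M.push 0 v) φ →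
    (∀ n : M.Num, M.Sat V (M.push n v) φ → M.Sat V (M.push (n + 1) v) φ) →
    ∀ n : M.Num, M.Sat V (M.push n v) φ
  delta1_comprehension : ∀ φ ψ : ArithFormula, φ.IsSigma1 → ψ.IsPi1 →
    ∀ (V : ℕ → M.sets) (v : ℕ → M.Num),
    (∀ n : M.Num, M.Sat V (M.push n v) φ ↔ M.Sat V (M.push n v) ψ) →
    ∃ X ∈ M.sets, ∀ n : M.Num, n ∈ X ↔ M.Sat V (M.push n v) φ

/-- `M` is a model of `ACA₀`: basic axioms, the induction axiom for sets, and comprehension for all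
arithmetical formulas with arbitrary number and set parameters. -/
structure ModelsACA0 : Prop where
  basic : M.IsDiscretelyOrderedSemiring
  induction_axiom : ∀ X ∈ M.sets, (0 : M.Num) ∈ X → (∀ n : M.Num, n ∈ X → n + 1 ∈ X) →
    ∀ n : M.Num, n ∈ X
  arithmetical_comprehension : ∀ (φ : ArithFormula) (V : ℕ → M.sets) (v : ℕ → M.Num),
    ∃ X ∈ M.sets, ∀ n : M.Num, n ∈ X ↔ M.Sat V (M.push n v) φ

/-! ### Codes for pairs, functions and finite sets, inside a structure -/

variable {M}

/-- The usual pairing `(a, b) = (a + b)² + a`. -/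
def pair (a b : M.Num) : M.Num := (a + b) * (a + b) + a

/-- `F`, a set of (codes of) ordered pairs, is a function from `A` to `B`. -/
def IsFunction (F A B : Set M.Num) : Prop :=
  (∀ p ∈ F, ∃ a ∈ A, ∃ b ∈ B, p = pair a b) ∧ ∀ a ∈ A, ∃! b, pair a b ∈ F

/-- `c` is of the form `(k, (m, n))`, as every code for a finite set is. -/
def IsTriple (c : M.Num) : Prop := ∃ k m n : M.Num, c = pair k (pair m n)

/-- `i` is an element of the finite set with code `c = (k, (m, n))`: `i < k` and `m (i + 1) + 1`
divides `n`. -/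
def MemCode (i c : M.Num) : Prop :=
  ∃ k m n : M.Num, c = pair k (pair m n) ∧ i < k ∧ ∃ q : M.Num, n = (m * (i + 1) + 1) * q

/-- `c` is the code of a finite set: the least triple that codes that set. -/
def IsFinCode (c : M.Num) : Prop :=
  IsTriple c ∧ ∀ d : M.Num, d < c → IsTriple d → ¬ ∀ i : M.Num, MemCode i d ↔ MemCode i c

/-- `Pf A` consists of the codes of the finite subsets of `A`. -/
def Pf (A : Set M.Num) : Set M.Num := {c | IsFinCode c ∧ ∀ i : M.Num, MemCode i c → i ∈ A}

variable (M)

/-! ### Quasi-orders -/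

/-- A quasi-order on a class of numbers of `M`. -/
structure QuasiOrder where
  carrier : Set M.Num
  le : M.Num → M.Num → Prop
  mem_of_le : ∀ a b : M.Num, le a b → a ∈ carrier ∧ b ∈ carrier
  refl : ∀ a ∈ carrier, le a a
  trans : ∀ a b c : M.Num, le a b → le b c → le a c

/-- The data of a countable second-countable space on which compactness depends: the points, the
indices, and for every index `i` the basic open set `basic i`. (The function `k` that witnesses
`x ∈ U_k(x,i,j) ⊆ U_i ∩ U_j` plays no role in the notions below; for the upper topology it is
`i ∪ j`.) -/
structure BasedSpace where
  points : Set M.Num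
  index : Set M.Num
  basic : M.Num → Set M.Num

variable {M}

namespace QuasiOrder

/-- The quasi-order belongs to the model: its domain and its order relation are sets of `M`. -/
def IsCoded (Q : M.QuasiOrder) : Prop :=
  Q.carrier ∈ M.sets ∧ {p : M.Num | ∃ a b : M.Num, Q.le a b ∧ p = pair a b} ∈ M.sets

/-- Every function `f : ℕ → Q` of the model satisfies `f m ≤ f n` for some `m < n`. -/
def IsWQO (Q : M.QuasiOrder) : Prop :=
  ∀ F ∈ M.sets, IsFunction F Set.univ Q.carrier →
    ∃ m n a b : M.Num, m < n ∧ pair m a ∈ F ∧ pair n b ∈ F ∧ Q.le a b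

/-- The finite subsets of `Q` with `A ≤♯ B` iff `∀ b ∈ B, ∃ a ∈ A, a ≤ b`. -/
def finSharp (Q : M.QuasiOrder) : M.QuasiOrder where
  carrier := Pf Q.carrier
  le A B := A ∈ Pf Q.carrier ∧ B ∈ Pf Q.carrier ∧
    ∀ b : M.Num, MemCode b B → ∃ a : M.Num, MemCode a A ∧ Q.le a b
  mem_of_le _ _ h := ⟨h.1, h.2.1⟩
  refl A hA := ⟨hA, hA, fun b hb => ⟨b, hb, Q.refl b (hA.2 b hb)⟩⟩
  trans := by
    rintro A B C ⟨hA, _, hAB⟩ ⟨_, hC, hBC⟩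
    refine ⟨hA, hC, fun c hc => ?_⟩
    obtain ⟨b, hb, hbc⟩ := hBC c hc
    obtain ⟨a, ha, hab⟩ := hAB b hb
    exact ⟨a, ha, Q.trans a b c hab hbc⟩

/-- The upper topology: the base is indexed by the finite subsets `i` of `Q`, and the `i`-th basic
open set is the complement of the downward closure of `i`. -/
def upper (Q : M.QuasiOrder) : M.BasedSpace where
  points := Q.carrier
  index := Pf Q.carrier
  basic i := {x | x ∈ Q.carrier ∧ ¬ ∃ e : M.Num, MemCode e i ∧ Q.le x e}

end QuasiOrder

namespace BasedSpace

/-- A code of an effectively open set: a function `h : ℕ → Pf I` of the model, where `I` is the set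
of indices. -/
def IsOpenCode (X : M.BasedSpace) (h : Set M.Num) : Prop :=
  h ∈ M.sets ∧ IsFunction h Set.univ (Pf X.index)

/-- The effectively open set coded by `h`: the union of the `U_i` with `i ∈ h n`, `n ∈ ℕ`. -/
def openSet (X : M.BasedSpace) (h : Set M.Num) : Set M.Num :=
  {x | x ∈ X.points ∧ ∃ n c i : M.Num, pair n c ∈ h ∧ MemCode i c ∧ x ∈ X.basic i}

/-- The union of the `U_i` with `i ∈ h n`, `n < N`. -/
def openSetBelow (X : M.BasedSpace) (h : Set M.Num) (N : M.Num) : Set M.Num :=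
  {x | x ∈ X.points ∧ ∃ n c i : M.Num, n < N ∧ pair n c ∈ h ∧ MemCode i c ∧ x ∈ X.basic i}

/-- The effectively open set coded by `h` is compact. -/
def IsCompactOpen (X : M.BasedSpace) (h : Set M.Num) : Prop :=
  ∀ f : Set M.Num, X.IsOpenCode f → X.openSet h ⊆ X.openSet f →
    ∃ N : M.Num, X.openSet h ⊆ X.openSetBelow f N

/-- Noetherian: every effectively open set is compact. -/
def IsNoetherian (X : M.BasedSpace) : Prop :=
  ∀ h : Set M.Num, X.IsOpenCode h → X.IsCompactOpen h

end BasedSpace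

end L2Structure

set_option linter.unusedSectionVars false

namespace L2Structure

/-! ### Arithmetic in a model of `RCA₀` -/

section Arithmetic

variable {M : L2Structure.{u}} [hM : Fact M.ModelsRCA0]

/-! Over RCA₀ it suffices to obtain all projections `∃ a, R a y`, and each of them can be read off
from the range of an injection `f` with `f 0 = 0`. Call a stage `k` true if no `i > k` has `f i < f
k`, and false otherwise; an unbounded list of true stages computes the range
(`Dec.range_of_true_stages`).

Put a false stage `k` below `n` as soon as stage `n` has seen its falsity, and let `Q` be the
product of this order with the numbers. A false stage lies below all late stages, so the terms of a
bad sequence in `Q` mostly sit at true stages, and the range exists whenever `Q` is not a wqo of the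
model (`Dec.range_of_not_isWQO`).

On the other hand, `upper (Pf♯ Q)` fails to be Noetherian unconditionally. There are finite sets `B
n`, recursive in `f`, such that for `m < n` some element of `B m` lies below no element of `B n`
(`inStage_bad`). Let `c n` be the set of the singletons of elements of `B n`. The elements of the `B
n` with `n < k` that lie below nothing in `B k` form a point of `V_(c k)` outside every `V_(c n)`
with `n < k`, so the union of all `V_(c n)` is not compact
(`QuasiOrder.not_isNoetherian_of_bad_family`). Under the hypothesis, `Q` is therefore not a wqo.

The rest is the development of recursive predicates (`Dec`), recursive functions (`Comp`) and
finite-set codes from Σ⁰₁ induction and Δ⁰₁ comprehension alone. -/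

instance instCommSemiringNum : CommSemiring M.Num where
  add_assoc := hM.out.basic.add_assoc
  zero_add a := by rw [hM.out.basic.add_comm, hM.out.basic.add_zero]
  add_zero := hM.out.basic.add_zero
  add_comm := hM.out.basic.add_comm
  mul_assoc := hM.out.basic.mul_assoc
  one_mul a := by rw [hM.out.basic.mul_comm, hM.out.basic.mul_one]
  mul_one := hM.out.basic.mul_one
  mul_comm := hM.out.basic.mul_comm
  left_distrib := hM.out.basic.mul_add
  right_distrib a b c := by
    rw [hM.out.basic.mul_comm, hM.out.basic.mul_add, hM.out.basic.mul_comm a,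
      hM.out.basic.mul_comm b]
  zero_mul a := by rw [hM.out.basic.mul_comm, hM.out.basic.mul_zero]
  mul_zero := hM.out.basic.mul_zero
  nsmul := nsmulRec
  npow := npowRec

noncomputable instance instLinearOrderNum : LinearOrder M.Num where
  lt := (· < ·)
  le a b := a < b ∨ a = b
  le_refl _ := Or.inr rfl
  le_trans := by
    rintro a b c (h | rfl) (h' | rfl)
    · exact Or.inl (hM.out.basic.lt_trans _ _ _ h h')
    · exact Or.inl h
    · exact Or.inl h'
    · exact Or.inr rfl
  lt_iff_le_not_ge a b := by
    constructor
    · refine fun h => ⟨Or.inl h, ?_⟩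
      rintro (h' | rfl)
      · exact hM.out.basic.lt_irrefl _ (hM.out.basic.lt_trans _ _ _ h h')
      · exact hM.out.basic.lt_irrefl _ h
    · rintro ⟨h | rfl, h'⟩
      · exact h
      · exact absurd (Or.inr rfl) h'
  le_antisymm := by
    rintro a b (h | rfl) (h' | h')
    · exact absurd (hM.out.basic.lt_trans _ _ _ h h') (hM.out.basic.lt_irrefl _)
    · exact h'.symm
    · rfl
    · rfl
  le_total a b := by
    rcases hM.out.basic.lt_total a b with h | h | h
    · exact Or.inl (Or.inl h)
    · exact Or.inl (Or.inr h)
    · exact Or.inr (Or.inl h)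
  toDecidableLE := Classical.decRel _

instance instIsStrictOrderedRingNum : IsStrictOrderedRing M.Num :=
  have add_left : ∀ a b c : M.Num, a ≤ b → c + a ≤ c + b := by
    rintro a b c (h | rfl)
    · rw [add_comm c, add_comm c]
      exact Or.inl (hM.out.basic.add_lt_add _ _ _ h)
    · exact le_rfl
  have mul_lt : ∀ a b c : M.Num, 0 < c → a < b → a * c < b * c := hM.out.basic.mul_lt_mul
  { add_le_add_left := fun a b h c => by
      simpa only [add_comm] using add_left a b c h
    le_of_add_le_add_left := fun a b c h => by
      by_contra hlt
      have h1 : c < b := not_le.mp hlt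
      have h2 : c + a < b + a := hM.out.basic.add_lt_add _ _ _ h1
      rw [add_comm c, add_comm b] at h2
      exact absurd h (not_le.mpr h2)
    zero_le_one := Or.inl hM.out.basic.zero_lt_one
    exists_pair_ne := ⟨0, 1, (show (0 : M.Num) < 1 from hM.out.basic.zero_lt_one).ne⟩
    mul_lt_mul_of_pos_left := fun c hc a b h => by
      simpa only [mul_comm] using mul_lt a b c hc h
    mul_lt_mul_of_pos_right := fun c hc a b h => mul_lt a b c hc h }

theorem num_nonneg (a : M.Num) : 0 ≤ a := by
  rcases hM.out.basic.nonneg a with rfl | h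
  · exact le_rfl
  · exact le_of_lt h

instance instCanonicallyOrderedAddNum : CanonicallyOrderedAdd M.Num where
  exists_add_of_le := by
    rintro a b (h | rfl)
    · obtain ⟨c, hc⟩ := hM.out.basic.exists_add_of_lt _ _ h
      exact ⟨c, hc.symm⟩
    · exact ⟨0, (add_zero _).symm⟩
  le_add_self a b := by
    simpa using add_le_add_left (num_nonneg b) a
  le_self_add a b := by
    simpa using add_le_add_right (num_nonneg b) a

theorem succ_le_iff {a b : M.Num} : a + 1 ≤ b ↔ a < b := by
  constructor
  · exact fun h => lt_of_lt_of_le (lt_add_of_pos_right _ zero_lt_one) h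
  · intro h
    obtain ⟨c, rfl⟩ := exists_add_of_le h.le
    have hc : 0 < c := by
      rcases hM.out.basic.nonneg c with rfl | hc
      · simp at h
      · exact hc
    refine add_le_add_right ?_ a
    rcases hM.out.basic.discrete c hc with rfl | h1
    · exact le_rfl
    · exact le_of_lt h1

theorem lt_succ_iff {a b : M.Num} : a < b + 1 ↔ a ≤ b := by
  rw [← not_le, succ_le_iff, not_lt]

theorem eq_zero_or_succ (a : M.Num) : a = 0 ∨ ∃ b, a = b + 1 := by
  rcases hM.out.basic.nonneg a with h | h
  · exact Or.inl h
  · obtain ⟨b, hb⟩ := exists_add_of_le (succ_le_iff.mpr h)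
    exact Or.inr ⟨b, by rw [hb]; ring⟩

theorem left_le_pair (a b : M.Num) : a ≤ pair a b := le_add_self

theorem le_mul_self (a : M.Num) : a ≤ a * a := by
  rcases eq_zero_or_succ a with rfl | ⟨b, rfl⟩
  · simp
  · exact le_mul_of_one_le_right (zero_le) le_add_self

theorem right_le_pair (a b : M.Num) : b ≤ pair a b :=
  le_add_self.trans ((le_mul_self (a + b)).trans le_self_add)

/-- With `s = a + b`, the code of `(a, b)` lies in the interval from `s²` to `s² + s`, which ends
before `(s + 1)²`. -/
theorem pair_lt_pair_of_add_lt {a b c d : M.Num} (h : a + b < c + d) : pair a b < pair c d := by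
  have h1 : (a + b + 1) * (a + b + 1) ≤ (c + d) * (c + d) :=
    mul_le_mul' (succ_le_iff.mpr h) (succ_le_iff.mpr h)
  refine lt_of_lt_of_le ?_ (h1.trans le_self_add)
  have h2 : pair a b + (a + b + b + 1) = (a + b + 1) * (a + b + 1) := by unfold pair; ring
  rw [← h2]
  exact lt_add_of_pos_right _ (lt_of_lt_of_le zero_lt_one le_add_self)

theorem pair_inj {a b c d : M.Num} : pair a b = pair c d ↔ a = c ∧ b = d := by
  refine ⟨fun h => ?_, by rintro ⟨rfl, rfl⟩; rfl⟩
  have hs : a + b = c + d := by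
    rcases lt_trichotomy (a + b) (c + d) with h1 | h1 | h1
    · exact absurd h (pair_lt_pair_of_add_lt h1).ne
    · exact h1
    · exact absurd h (pair_lt_pair_of_add_lt h1).ne'
  have ha : a = c := by
    unfold pair at h
    rw [hs] at h
    exact add_left_cancel h
  subst ha
  exact ⟨rfl, add_left_cancel hs⟩

theorem pair_le_pair {a b c d : M.Num} (h : a ≤ c) (h' : b ≤ d) : pair a b ≤ pair c d :=
  add_le_add (mul_le_mul' (add_le_add h h') (add_le_add h h')) h

open Classical in
/-- The first component of a pair, and `0` for a number that is not a pair. -/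
noncomputable def left (p : M.Num) : M.Num :=
  if h : ∃ a b : M.Num, p = pair a b then h.choose else 0

open Classical in
/-- The second component of a pair, and `0` for a number that is not a pair. -/
noncomputable def right (p : M.Num) : M.Num :=
  if h : ∃ a b : M.Num, p = pair a b then h.choose_spec.choose else 0

theorem pair_left_right {p : M.Num} (h : ∃ a b : M.Num, p = pair a b) :
    pair (left p) (right p) = p := by
  unfold left right
  rw [dif_pos h, dif_pos h]
  exact h.choose_spec.choose_spec.symm

@[simp] theorem left_pair (a b : M.Num) : left (pair a b) = a :=
  (pair_inj.mp (pair_left_right ⟨a, b, rfl⟩)).1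

@[simp] theorem right_pair (a b : M.Num) : right (pair a b) = b :=
  (pair_inj.mp (pair_left_right ⟨a, b, rfl⟩)).2

end Arithmetic

/-! ### Recursive predicates and functions of a model -/

section Recursive

variable {M : L2Structure.{u}}

/-- The predicate `P` is coded by a set of the model. -/
def Dec (P : M.Num → Prop) : Prop := {n | P n} ∈ M.sets

/-- The graph of the function `g` is coded by a set of the model. -/
def Comp (g : M.Num → M.Num) : Prop := {p | ∃ n, p = pair n (g n)} ∈ M.sets

/-- The assignment of set variables that lists `X`, `Y` and then `Z` forever. -/
def setAssign (X Y Z : M.sets) : ℕ → M.sets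
  | 0 => X
  | 1 => Y
  | _ => Z

/-- The term for the code of a pair. -/
def pairTerm (s t : ArithTerm) : ArithTerm := .add (.mul (.add s t) (.add s t)) s

@[simp] theorem termVal_pairTerm (v : ℕ → M.Num) (s t : ArithTerm) :
    M.termVal v (pairTerm s t) = pair (M.termVal v s) (M.termVal v t) := rfl

variable [hM : Fact M.ModelsRCA0]

/-! ### Closure properties of recursive predicates and functions -/

theorem Dec.of_sat_iff {P : M.Num → Prop} (φ ψ : ArithFormula) (hφ : φ.IsBounded)
    (hψ : ψ.IsBounded) (V : ℕ → M.sets) (v : ℕ → M.Num)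
    (h₁ : ∀ n, P n ↔ ∃ a, M.Sat V (M.push a (M.push n v)) φ)
    (h₂ : ∀ n, P n ↔ ∀ a, M.Sat V (M.push a (M.push n v)) ψ) : Dec P := by
  obtain ⟨X, hX, hXP⟩ := hM.out.delta1_comprehension (.ex φ) (.all ψ) ⟨φ, hφ, rfl⟩ ⟨ψ, hψ, rfl⟩ V v
    fun n => (h₁ n).symm.trans (h₂ n)
  have : {n | P n} = X := Set.ext fun n => (h₁ n).trans (hXP n).symm
  rw [Dec, this]
  exact hX

/-- A bounded formula becomes Σ⁰₁ and Π⁰₁ by a dummy quantifier. This uses up `var 0`, so the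
argument `n` is `var 1`. -/
theorem Dec.of_sat {P : M.Num → Prop} (φ : ArithFormula) (hφ : φ.IsBounded)
    (V : ℕ → M.sets) (v : ℕ → M.Num)
    (h : ∀ n a, P n ↔ M.Sat V (M.push a (M.push n v)) φ) : Dec P :=
  .of_sat_iff φ φ hφ hφ V v (fun n => (h n 0).trans ⟨fun h0 => ⟨0, h0⟩, fun ⟨a, ha⟩ =>
    (h n 0).mp ((h n a).mpr ha)⟩) fun n => ⟨fun hn a => (h n a).mp hn, fun ha => (h n 0).mpr (ha 0)⟩

theorem Dec.and {P Q : M.Num → Prop} (hP : Dec P) (hQ : Dec Q) : Dec fun n => P n ∧ Q n :=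
  .of_sat (.and (.mem (.var 1) 0) (.mem (.var 1) 1)) ⟨trivial, trivial⟩
    (setAssign ⟨_, hP⟩ ⟨_, hQ⟩ ⟨_, hQ⟩) (fun _ => 0) fun _ _ => Iff.rfl

theorem Dec.not {P : M.Num → Prop} (hP : Dec P) : Dec fun n => ¬ P n :=
  .of_sat (.neg (.mem (.var 1) 0)) trivial
    (fun _ => ⟨_, hP⟩) (fun _ => 0) fun _ _ => Iff.rfl

theorem Dec.imp {P Q : M.Num → Prop} (hP : Dec P) (hQ : Dec Q) : Dec fun n => P n → Q n :=
  .of_sat (.imp (.mem (.var 1) 0) (.mem (.var 1) 1)) ⟨trivial, trivial⟩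
    (setAssign ⟨_, hP⟩ ⟨_, hQ⟩ ⟨_, hQ⟩) (fun _ => 0) fun _ _ => Iff.rfl

theorem Dec.or {P Q : M.Num → Prop} (hP : Dec P) (hQ : Dec Q) : Dec fun n => P n ∨ Q n :=
  .of_sat (.or (.mem (.var 1) 0) (.mem (.var 1) 1)) ⟨trivial, trivial⟩
    (setAssign ⟨_, hP⟩ ⟨_, hQ⟩ ⟨_, hQ⟩) (fun _ => 0) fun _ _ => Iff.rfl

theorem Dec.congr {P Q : M.Num → Prop} (hP : Dec P) (h : ∀ n, Q n ↔ P n) : Dec Q := by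
  have : Q = P := funext fun n => propext (h n)
  exact this ▸ hP

theorem Dec.iff {P Q : M.Num → Prop} (hP : Dec P) (hQ : Dec Q) : Dec fun n => P n ↔ Q n :=
  ((hP.imp hQ).and (hQ.imp hP)).congr fun _ => iff_iff_implies_and_implies

theorem pair_mem_graph {g : M.Num → M.Num} {n y : M.Num} :
    pair n y ∈ {p : M.Num | ∃ n, p = pair n (g n)} ↔ y = g n := by
  simp [pair_inj]

theorem Dec.comp {P : M.Num → Prop} {g : M.Num → M.Num} (hP : Dec P) (hg : Comp g) :
    Dec fun n => P (g n) := by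
  refine .of_sat_iff (.and (.mem (pairTerm (.var 1) (.var 0)) 0) (.mem (.var 0) 1))
    (.imp (.mem (pairTerm (.var 1) (.var 0)) 0) (.mem (.var 0) 1))
    ⟨trivial, trivial⟩ ⟨trivial, trivial⟩ (setAssign ⟨_, hg⟩ ⟨_, hP⟩ ⟨_, hP⟩) (fun _ => 0)
    (fun n => ?_) (fun n => ?_) <;>
  simp [Sat, termVal, push, setAssign, pair_inj]

/-- `Δ⁰₁` comprehension, with both matrices coded by sets. -/
theorem Dec.of_ex_all {P : M.Num → Prop} {R S : M.Num → M.Num → Prop}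
    (hR : Dec fun p => R (left p) (right p)) (hS : Dec fun p => S (left p) (right p))
    (h₁ : ∀ n, P n ↔ ∃ a, R a n) (h₂ : ∀ n, P n ↔ ∀ a, S a n) : Dec P := by
  refine .of_sat_iff (.mem (pairTerm (.var 0) (.var 1)) 0) (.mem (pairTerm (.var 0) (.var 1)) 1)
    trivial trivial (setAssign ⟨_, hR⟩ ⟨_, hS⟩ ⟨_, hS⟩) (fun _ => 0)
    (fun n => ?_) (fun n => ?_)
  · simp [Sat, termVal, push, setAssign, h₁]
  · simp [Sat, termVal, push, setAssign, h₂]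

/-- `Σ⁰₁` induction, with the matrix coded by a set. -/
theorem sigma_induction {R : M.Num → M.Num → Prop} (hR : Dec fun p => R (left p) (right p))
    (h0 : ∃ a, R a 0) (hs : ∀ n, (∃ a, R a n) → ∃ a, R a (n + 1)) (n : M.Num) : ∃ a, R a n := by
  have := hM.out.sigma1_induction (.ex (.mem (pairTerm (.var 0) (.var 1)) 0))
    ⟨.mem (pairTerm (.var 0) (.var 1)) 0, trivial, rfl⟩
    (fun _ => ⟨_, hR⟩) (fun _ => 0)
  simp only [Sat, termVal, push, termVal_pairTerm, Set.mem_ofPred_eq, left_pair, right_pair] at this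
  exact this h0 hs n

theorem Dec.exists_eq_pair : Dec fun p : M.Num => ∃ a b, p = pair a b := by
  refine .of_sat (.bex (.add (.var 1) .one) (.bex (.add (.var 2) .one)
    (.eq (.var 3) (pairTerm (.var 1) (.var 0))))) trivial
    (fun _ => ⟨_, M.sets_nonempty.some_mem⟩) (fun _ => 0) fun n c => ?_
  simp only [Sat, termVal, push, termVal_pairTerm, lt_succ_iff]
  constructor
  · rintro ⟨a, b, rfl⟩
    exact ⟨a, left_le_pair _ _, b, right_le_pair _ _, rfl⟩
  · rintro ⟨a, -, b, -, rfl⟩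
    exact ⟨a, b, rfl⟩

/-- A total function with a Σ⁰₁ graph has a Δ⁰₁ graph. The Π⁰₁ form says of `(n, y)` that for every
bound `b`, each value below `b` with a witness below `b` equals `y`. -/
theorem Comp.of_sigma {g : M.Num → M.Num} {R : M.Num → Prop} (hR : Dec R)
    (h : ∀ n y, y = g n ↔ ∃ a, R (pair a (pair n y))) : Comp g := by
  refine Dec.of_sat_iff (.and (.mem (.var 1) 1) (.mem (pairTerm (.var 0) (.var 1)) 0))
    (.and (.mem (.var 1) 1) (.bex (.add (.var 1) .one) (.bex (.add (.var 2) .one)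
      (.and (.eq (.var 3) (pairTerm (.var 1) (.var 0)))
      (.ball (.var 2) (.ball (.var 3)
        (.imp (.mem (pairTerm (.var 0) (pairTerm (.var 3) (.var 1))) 0)
          (.eq (.var 1) (.var 2)))))))))
    ⟨trivial, trivial⟩ ⟨trivial, trivial, trivial, trivial⟩
    (setAssign ⟨_, hR⟩ ⟨_, Dec.exists_eq_pair⟩ ⟨_, hR⟩) (fun _ => 0)
    (fun p => ?_) (fun p => ?_)
  · simp only [Sat, termVal, push, termVal_pairTerm, setAssign, Set.mem_ofPred_eq]
    constructor
    · rintro ⟨n, rfl⟩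
      obtain ⟨a, ha⟩ := (h n (g n)).mp rfl
      exact ⟨a, ⟨_, _, rfl⟩, ha⟩
    · rintro ⟨a, ⟨n, y, rfl⟩, ha⟩
      exact ⟨n, by rw [(h n y).mpr ⟨a, ha⟩]⟩
  · simp only [Sat, termVal, push, termVal_pairTerm, setAssign, Set.mem_ofPred_eq, lt_succ_iff]
    constructor
    · rintro ⟨n, rfl⟩ b
      exact ⟨⟨_, _, rfl⟩, n, left_le_pair _ _, g n, right_le_pair _ _, rfl,
        fun y _ a _ ha => (h n y).mpr ⟨a, ha⟩⟩
    · intro H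
      obtain ⟨n, y, rfl⟩ := (H 0).1
      obtain ⟨a, ha⟩ := (h n (g n)).mp rfl
      obtain ⟨-, n', -, y', -, he, hy⟩ := H (max (g n) a + 1)
      obtain ⟨rfl, rfl⟩ := pair_inj.mp he
      have := hy (g n) (lt_succ_iff.mpr (le_max_left _ _)) a (lt_succ_iff.mpr (le_max_right _ _)) ha
      exact ⟨n, by rw [this]⟩

theorem Comp.of_term {g : M.Num → M.Num} (t : ArithTerm) (c : M.Num)
    (h : ∀ n a p, M.termVal (M.push n (M.push a (M.push p fun _ => c))) t = g n) : Comp g := by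
  refine Dec.of_sat (.bex (.add (.var 1) .one) (.eq (.var 2) (pairTerm (.var 0) t))) trivial
    (fun _ => ⟨_, M.sets_nonempty.some_mem⟩) (fun _ => c) fun p a => ?_
  simp only [Sat, termVal_pairTerm, h]
  simp only [termVal, push, lt_succ_iff]
  constructor
  · rintro ⟨n, rfl⟩
    exact ⟨n, left_le_pair _ _, rfl⟩
  · rintro ⟨n, -, rfl⟩
    exact ⟨n, rfl⟩

theorem Comp.id : Comp fun n : M.Num => n := .of_term (.var 0) 0 fun _ _ _ => rfl

theorem Comp.const (c : M.Num) : Comp fun _ : M.Num => c := .of_term (.var 3) c fun _ _ _ => rfl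

/-- The values `f n` and `g n` need not be bounded in terms of `n` and `k n`. The pair `(f n, g n)`
is therefore kept as a witness, which makes the relation bounded, and `Comp.of_sigma` projects it
away. -/
theorem Comp.of_term₂ {f g k : M.Num → M.Num} (hf : Comp f) (hg : Comp g) (t : ArithTerm)
    (h : ∀ n w, M.termVal (M.push (f n) (M.push (g n) w)) t = k n) : Comp k := by
  have hR : Dec fun q => ∃ n, q = pair (pair (f n) (g n)) (pair n (k n)) := by
    refine .of_sat (.bex (.add (.var 1) .one) (.bex (.add (.var 2) .one)
      (.bex (.add (.var 3) .one)
        (.and (.and (.mem (pairTerm (.var 2) (.var 0)) 0) (.mem (pairTerm (.var 2) (.var 1)) 1))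
        (.eq (.var 4) (pairTerm (pairTerm (.var 0) (.var 1)) (pairTerm (.var 2) t)))))))
      ⟨⟨trivial, trivial⟩, trivial⟩ (setAssign ⟨_, hf⟩ ⟨_, hg⟩ ⟨_, hg⟩) (fun _ => 0) fun q a => ?_
    simp only [Sat, termVal_pairTerm, setAssign, pair_mem_graph]
    constructor
    · rintro ⟨n, rfl⟩
      refine ⟨n, ?_, g n, ?_, f n, ?_, ⟨rfl, rfl⟩, ?_⟩
      · simp only [termVal, push, lt_succ_iff]
        exact (left_le_pair _ _).trans (right_le_pair _ _)
      · simp only [termVal, push, lt_succ_iff]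
        exact (right_le_pair _ _).trans (left_le_pair _ _)
      · simp only [termVal, push, lt_succ_iff]
        exact (left_le_pair _ _).trans (left_le_pair _ _)
      · rw [h]
        rfl
    · rintro ⟨n, -, v, -, u, -, ⟨hu, hv⟩, hq⟩
      obtain rfl : u = f n := hu
      obtain rfl : v = g n := hv
      rw [h] at hq
      exact ⟨n, hq⟩
  refine .of_sigma hR fun n y => ?_
  constructor
  · rintro rfl
    exact ⟨_, n, rfl⟩
  · rintro ⟨a, n', ha⟩
    obtain ⟨rfl, rfl⟩ := pair_inj.mp (pair_inj.mp ha).2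
    rfl

theorem Comp.add {f g : M.Num → M.Num} (hf : Comp f) (hg : Comp g) : Comp fun n => f n + g n :=
  .of_term₂ hf hg (.add (.var 0) (.var 1)) fun _ _ => rfl

theorem Comp.mul {f g : M.Num → M.Num} (hf : Comp f) (hg : Comp g) : Comp fun n => f n * g n :=
  .of_term₂ hf hg (.mul (.var 0) (.var 1)) fun _ _ => rfl

theorem Comp.pair {f g : M.Num → M.Num} (hf : Comp f) (hg : Comp g) :
    Comp fun n => pair (f n) (g n) :=
  .of_term₂ hf hg (pairTerm (.var 0) (.var 1)) fun _ _ => rfl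

theorem Comp.left_self : Comp fun n : M.Num => left n := by
  refine Dec.of_sat (.bex (.add (.var 1) .one) (.or
    (.bex (.add (.var 0) .one) (.bex (.add (.var 1) .one)
      (.and (.eq (.var 2) (pairTerm (.var 1) (.var 0))) (.eq (.var 4) (pairTerm (.var 2) (.var 1))))))
    (.and (.neg (.mem (.var 0) 0)) (.eq (.var 2) (pairTerm (.var 0) .zero)))))
    ⟨⟨trivial, trivial⟩, trivial, trivial⟩ (fun _ => ⟨_, Dec.exists_eq_pair⟩) (fun _ => 0)
    fun q c => ?_
  simp only [Sat, termVal, push, termVal_pairTerm, Set.mem_ofPred_eq, lt_succ_iff]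
  constructor
  · rintro ⟨p, rfl⟩
    refine ⟨p, left_le_pair _ _, ?_⟩
    by_cases hp : ∃ a b, p = L2Structure.pair a b
    · obtain ⟨a, b, rfl⟩ := hp
      exact Or.inl ⟨a, left_le_pair _ _, b, right_le_pair _ _, rfl, by rw [left_pair]⟩
    · exact Or.inr ⟨hp, by rw [left, dif_neg hp]⟩
  · rintro ⟨p, -, ⟨a, -, b, -, rfl, rfl⟩ | ⟨hp, rfl⟩⟩
    · exact ⟨_, by rw [left_pair]⟩
    · exact ⟨p, by rw [left, dif_neg hp]⟩

theorem Comp.right_self : Comp fun n : M.Num => right n := by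
  refine Dec.of_sat (.bex (.add (.var 1) .one) (.or
    (.bex (.add (.var 0) .one) (.bex (.add (.var 1) .one)
      (.and (.eq (.var 2) (pairTerm (.var 1) (.var 0))) (.eq (.var 4) (pairTerm (.var 2) (.var 0))))))
    (.and (.neg (.mem (.var 0) 0)) (.eq (.var 2) (pairTerm (.var 0) .zero)))))
    ⟨⟨trivial, trivial⟩, trivial, trivial⟩ (fun _ => ⟨_, Dec.exists_eq_pair⟩) (fun _ => 0)
    fun q c => ?_
  simp only [Sat, termVal, push, termVal_pairTerm, Set.mem_ofPred_eq, lt_succ_iff]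
  constructor
  · rintro ⟨p, rfl⟩
    refine ⟨p, left_le_pair _ _, ?_⟩
    by_cases hp : ∃ a b, p = L2Structure.pair a b
    · obtain ⟨a, b, rfl⟩ := hp
      exact Or.inl ⟨a, left_le_pair _ _, b, right_le_pair _ _, rfl, by rw [right_pair]⟩
    · exact Or.inr ⟨hp, by rw [right, dif_neg hp]⟩
  · rintro ⟨p, -, ⟨a, -, b, -, rfl, rfl⟩ | ⟨hp, rfl⟩⟩
    · exact ⟨_, by rw [right_pair]⟩
    · exact ⟨p, by rw [right, dif_neg hp]⟩

theorem Comp.comp {f g : M.Num → M.Num} (hf : Comp f) (hg : Comp g) : Comp fun n => f (g n) := by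
  have hR : Dec fun q => ∃ n, q = L2Structure.pair (g n) (L2Structure.pair n (f (g n))) := by
    refine .of_sat (.bex (.add (.var 1) .one) (.bex (.add (.var 2) .one)
      (.bex (.add (.var 3) .one)
        (.and (.and (.mem (pairTerm (.var 2) (.var 0)) 0) (.mem (pairTerm (.var 0) (.var 1)) 1))
        (.eq (.var 4) (pairTerm (.var 0) (pairTerm (.var 2) (.var 1))))))))
      ⟨⟨trivial, trivial⟩, trivial⟩ (setAssign ⟨_, hg⟩ ⟨_, hf⟩ ⟨_, hf⟩) (fun _ => 0) fun q a => ?_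
    simp only [Sat, termVal_pairTerm, setAssign, pair_mem_graph, termVal, push, lt_succ_iff]
    constructor
    · rintro ⟨n, rfl⟩
      exact ⟨n, (left_le_pair _ _).trans (right_le_pair _ _), _,
        (right_le_pair _ _).trans (right_le_pair _ _), _, left_le_pair _ _, ⟨rfl, rfl⟩, rfl⟩
    · rintro ⟨n, -, v, -, u, -, ⟨rfl, rfl⟩, rfl⟩
      exact ⟨n, rfl⟩
  refine .of_sigma hR fun n y => ?_
  constructor
  · rintro rfl
    exact ⟨_, n, rfl⟩
  · rintro ⟨a, n', ha⟩
    obtain ⟨rfl, rfl⟩ := pair_inj.mp (pair_inj.mp ha).2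
    rfl

theorem Comp.left {f : M.Num → M.Num} (hf : Comp f) : Comp fun n => left (f n) :=
  Comp.left_self.comp hf

theorem Comp.right {f : M.Num → M.Num} (hf : Comp f) : Comp fun n => right (f n) :=
  Comp.right_self.comp hf

theorem Dec.comp₂ {P : M.Num → M.Num → Prop} {f g : M.Num → M.Num}
    (hP : Dec fun p => P (left p) (right p)) (hf : Comp f) (hg : Comp g) :
    Dec fun n => P (f n) (g n) := by
  simpa using hP.comp (hf.pair hg)

theorem Dec.eq {f g : M.Num → M.Num} (hf : Comp f) (hg : Comp g) : Dec fun n => f n = g n := by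
  have : Dec fun q : M.Num => ∃ a b, q = L2Structure.pair a b ∧ a = b := by
    refine .of_sat (.bex (.add (.var 1) .one) (.bex (.add (.var 2) .one)
      (.and (.eq (.var 3) (pairTerm (.var 1) (.var 0))) (.eq (.var 1) (.var 0)))))
      ⟨trivial, trivial⟩ (fun _ => ⟨_, M.sets_nonempty.some_mem⟩) (fun _ => 0) fun n c => ?_
    simp only [Sat, termVal, push, termVal_pairTerm, lt_succ_iff]
    constructor
    · rintro ⟨a, b, rfl, h⟩
      exact ⟨a, left_le_pair _ _, b, right_le_pair _ _, rfl, h⟩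
    · rintro ⟨a, -, b, -, rfl, h⟩
      exact ⟨a, b, rfl, h⟩
  refine (this.comp (hf.pair hg)).congr fun n => ⟨fun h => ⟨_, _, rfl, h⟩, ?_⟩
  rintro ⟨a, b, h, hab⟩
  obtain ⟨h₁, h₂⟩ := pair_inj.mp h
  rwa [h₁, h₂]

theorem Dec.lt {f g : M.Num → M.Num} (hf : Comp f) (hg : Comp g) : Dec fun n => f n < g n := by
  have : Dec fun q : M.Num => ∃ a b, q = L2Structure.pair a b ∧ a < b := by
    refine .of_sat (.bex (.add (.var 1) .one) (.bex (.add (.var 2) .one)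
      (.and (.eq (.var 3) (pairTerm (.var 1) (.var 0))) (.lt (.var 1) (.var 0)))))
      ⟨trivial, trivial⟩ (fun _ => ⟨_, M.sets_nonempty.some_mem⟩) (fun _ => 0) fun n c => ?_
    simp only [Sat, termVal, push, termVal_pairTerm, lt_succ_iff]
    constructor
    · rintro ⟨a, b, rfl, h⟩
      exact ⟨a, left_le_pair _ _, b, right_le_pair _ _, rfl, h⟩
    · rintro ⟨a, -, b, -, rfl, h⟩
      exact ⟨a, b, rfl, h⟩
  refine (this.comp (hf.pair hg)).congr fun n => ⟨fun h => ⟨_, _, rfl, h⟩, ?_⟩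
  rintro ⟨a, b, h, hab⟩
  obtain ⟨h₁, h₂⟩ := pair_inj.mp h
  rwa [h₁, h₂]

theorem Dec.le {f g : M.Num → M.Num} (hf : Comp f) (hg : Comp g) : Dec fun n => f n ≤ g n :=
  ((Dec.lt hg hf).not).congr fun _ => not_lt.symm

theorem Dec.bex {R : M.Num → M.Num → Prop} {g : M.Num → M.Num}
    (hR : Dec fun p => R (L2Structure.left p) (L2Structure.right p)) (hg : Comp g) :
    Dec fun n => ∃ a, a < g n ∧ R a n := by
  have : Dec fun q : M.Num => ∃ b n, q = L2Structure.pair b n ∧ ∃ a, a < b ∧ R a n := by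
    refine .of_sat (.bex (.add (.var 1) .one) (.bex (.add (.var 2) .one)
      (.and (.eq (.var 3) (pairTerm (.var 1) (.var 0)))
        (.bex (.var 1) (.mem (pairTerm (.var 0) (.var 1)) 0)))))
      ⟨trivial, trivial⟩ (fun _ => ⟨_, hR⟩) (fun _ => 0) fun n c => ?_
    simp only [Sat, termVal, push, termVal_pairTerm, lt_succ_iff, Set.mem_ofPred_eq, left_pair,
      right_pair]
    constructor
    · rintro ⟨a, b, rfl, h⟩
      exact ⟨a, left_le_pair _ _, b, right_le_pair _ _, rfl, h⟩
    · rintro ⟨a, -, b, -, rfl, h⟩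
      exact ⟨a, b, rfl, h⟩
  refine (this.comp (hg.pair .id)).congr fun n => ⟨fun h => ⟨_, _, rfl, h⟩, ?_⟩
  rintro ⟨b, n', h, hab⟩
  obtain ⟨h₁, h₂⟩ := pair_inj.mp h
  rwa [h₁, h₂]

theorem Dec.ball {R : M.Num → M.Num → Prop} {g : M.Num → M.Num}
    (hR : Dec fun p => R (L2Structure.left p) (L2Structure.right p)) (hg : Comp g) :
    Dec fun n => ∀ a, a < g n → R a n :=
  (Dec.bex (R := fun a n => ¬ R a n) hR.not hg).not.congr fun n => by push Not; rfl

theorem Comp.of_graph {g : M.Num → M.Num} {R : M.Num → M.Num → Prop}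
    (hR : Dec fun p => R (L2Structure.left p) (L2Structure.right p))
    (h : ∀ n y, y = g n ↔ R y n) : Comp g :=
  .of_sigma (R := fun q => R (L2Structure.right (L2Structure.right q))
      (L2Structure.left (L2Structure.right q)))
    (hR.comp₂ Comp.id.right.right Comp.id.right.left) fun n y => by simp [h]

/-! ### Induction and least number principles -/

/-- Induction for a predicate coded by a set. -/
theorem Dec.induction {P : M.Num → Prop} (hP : Dec P) (h0 : P 0) (hs : ∀ n, P n → P (n + 1))
    (n : M.Num) : P n :=
  (sigma_induction (R := fun _ n => P n) (hP.comp .right_self) ⟨0, h0⟩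
    (fun n ⟨_, hn⟩ => ⟨0, hs n hn⟩) n).elim fun _ h => h

/-- The least number principle for a predicate coded by a set. -/
theorem Dec.exists_least {P : M.Num → Prop} (hP : Dec P) {n : M.Num} (hn : P n) :
    ∃ m, P m ∧ ∀ k, k < m → ¬ P k := by
  by_contra! H
  have : ∀ n, ∀ k, k < n → ¬ P k := by
    refine Dec.induction ?_ (fun k hk => absurd hk (zero_le).not_gt) fun n ih k hk hPk => ?_
    · exact Dec.ball (R := fun k _ => ¬ P k) (hP.comp .left_self).not .id
    · obtain ⟨j, hj, hPj⟩ := H k hPk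
      exact ih j (lt_of_lt_of_le hj (lt_succ_iff.mp hk)) hPj
  exact this (n + 1) n (lt_succ_iff.mpr le_rfl) hn

/-- Induction for the complement of a `Σ⁰₁` class. -/
theorem pi_induction {R : M.Num → M.Num → Prop} (hR : Dec fun p => R (left p) (right p))
    (h0 : ∀ a, R a 0) (hs : ∀ n, (∀ a, R a n) → ∀ a, R a (n + 1)) (n : M.Num) : ∀ a, R a n := by
  by_contra! H
  -- the complement of the class is closed downwards along `n - i`
  have key : ∀ i, ∃ a, i ≤ n → ∃ j, j < n + 1 ∧ j + i = n ∧ ¬ R a j := by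
    refine sigma_induction
      (R := fun a i => i ≤ n → ∃ j, j < n + 1 ∧ j + i = n ∧ ¬ R a j) ?_ ?_ ?_
    · refine (Dec.le .right_self (.const n)).imp (.bex (R := fun j p => j + right p = n ∧
        ¬ R (left p) j) ?_ (.const _))
      exact (Dec.eq (Comp.left_self.add Comp.id.right.right) (.const n)).and
        (hR.comp₂ Comp.id.right.left Comp.left_self).not
    · obtain ⟨a, ha⟩ := H
      exact ⟨a, fun _ => ⟨n, lt_succ_iff.mpr le_rfl, add_zero _, ha⟩⟩
    · rintro i ⟨a, ha⟩
      by_cases hi : i + 1 ≤ n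
      · obtain ⟨j, -, hj, hRj⟩ := ha (le_self_add.trans hi)
        rcases eq_zero_or_succ j with rfl | ⟨j, rfl⟩
        · exact absurd (h0 a) hRj
        · obtain ⟨b, hb⟩ : ∃ b, ¬ R b j := by
            by_contra! hall
            exact hRj (hs j hall a)
          have he : j + (i + 1) = n := by rw [← hj]; ring
          exact ⟨b, fun _ => ⟨j, lt_succ_iff.mpr (he ▸ le_self_add), he, hb⟩⟩
      · exact ⟨0, fun h => absurd h hi⟩
  obtain ⟨a, ha⟩ := key n
  obtain ⟨j, -, hj, hRj⟩ := ha le_rfl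
  obtain rfl : j = 0 := by simpa using hj
  exact hRj (h0 a)

/-- The least number principle for a `Σ⁰₁` class. -/
theorem sigma_exists_least {R : M.Num → M.Num → Prop} (hR : Dec fun p => R (left p) (right p))
    {n : M.Num} (hn : ∃ a, R a n) : ∃ m, (∃ a, R a m) ∧ ∀ k, k < m → ¬ ∃ a, R a k := by
  by_contra! H
  -- With the unbounded quantifier outside the bounded one, this is Π⁰₁ as it stands and no
  -- collection principle is needed.
  have : ∀ n, ∀ a, ∀ k, k < n → ¬ R a k := by
    refine pi_induction (R := fun a n => ∀ k, k < n → ¬ R a k) ?_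
      (fun a k hk => absurd hk (zero_le).not_gt) fun n ih a k hk hRk => ?_
    · exact Dec.ball (R := fun k p => ¬ R (left p) k)
        (hR.comp₂ Comp.id.right.left Comp.left_self).not .right_self
    · obtain ⟨j, hj, b, hRj⟩ := H k ⟨a, hRk⟩
      exact ih b j (lt_of_lt_of_le hj (lt_succ_iff.mp hk)) hRj
  obtain ⟨a, ha⟩ := hn
  exact this (n + 1) a n (lt_succ_iff.mpr le_rfl) ha

/-- The least upper bound is attained, since otherwise its predecessor would be an upper bound. The
bound `b` makes being an upper bound a recursive property. -/
theorem Dec.exists_greatest {P : M.Num → Prop} (hP : Dec P) {n b : M.Num} (hn : P n)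
    (hb : ∀ k, P k → k ≤ b) : ∃ m, P m ∧ ∀ k, P k → k ≤ m := by
  obtain ⟨m, hm, hmin⟩ := Dec.exists_least (P := fun m => ∀ k, k < b + 1 → P k → k ≤ m)
    (Dec.ball (R := fun k m => P k → k ≤ m) ((hP.comp .left_self).imp (.le .left_self .right_self))
      (.const _)) (n := b) fun k _ hk => hb k hk
  have hm' : ∀ k, P k → k ≤ m := fun k hk => hm k (lt_succ_iff.mpr (hb k hk)) hk
  refine ⟨m, ?_, hm'⟩
  rcases eq_zero_or_succ m with rfl | ⟨m', rfl⟩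
  · obtain rfl : n = 0 := le_antisymm (hm' n hn) zero_le
    exact hn
  · have := hmin m' (lt_succ_iff.mpr le_rfl)
    push Not at this
    obtain ⟨k, -, hk, hlt⟩ := this
    obtain rfl : k = m' + 1 := le_antisymm (hm' k hk) (succ_le_iff.mpr hlt)
    exact hk

open Classical in
/-- The least number with the property `R · n`, or `0` if there is none. -/
noncomputable def least (R : M.Num → M.Num → Prop) (n : M.Num) : M.Num :=
  if h : ∃ y, R y n ∧ ∀ z, z < y → ¬ R z n then h.choose else 0

theorem least_spec {R : M.Num → M.Num → Prop} (hR : Dec fun p => R (left p) (right p))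
    {n : M.Num} (h : ∃ y, R y n) : R (least R n) n ∧ ∀ z, z < least R n → ¬ R z n := by
  obtain ⟨y, hy⟩ := h
  have := Dec.exists_least (P := fun y => R y n) (hR.comp₂ .id (.const n)) hy
  rw [least, dif_pos this]
  exact this.choose_spec

theorem Comp.least {R : M.Num → M.Num → Prop}
    (hR : Dec fun p => R (L2Structure.left p) (L2Structure.right p))
    (h : ∀ n, ∃ y, R y n) : Comp (least R) := by
  refine .of_graph (R := fun y n => R y n ∧ ∀ z, z < y → ¬ R z n)
    (hR.and (.ball (R := fun z p => ¬ R z (L2Structure.right p))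
      (hR.comp₂ .left_self Comp.id.right.right).not .left_self)) fun n y => ?_
  obtain ⟨h₁, h₂⟩ := least_spec hR (h n)
  refine ⟨by rintro rfl; exact ⟨h₁, h₂⟩, fun ⟨h₃, h₄⟩ => ?_⟩
  exact le_antisymm (not_lt.mp fun hlt => h₄ _ hlt h₁) (not_lt.mp fun hlt => h₂ _ hlt h₃)

end Recursive

end L2Structure

namespace L2Structure

section FiniteSets

variable {M : L2Structure.{u}} [hM : Fact M.ModelsRCA0]

/-! ### Divisibility and codes of finite sets -/

theorem num_dvd_of_dvd_add {a x y : M.Num} (h : a ∣ x + y) (hx : a ∣ x) : a ∣ y := by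
  obtain ⟨q, hq⟩ := h
  obtain ⟨r, rfl⟩ := hx
  rcases le_total r q with h | h
  · obtain ⟨s, rfl⟩ := exists_add_of_le h
    rw [mul_add] at hq
    exact ⟨s, add_left_cancel hq⟩
  · have h₁ : a * r + y ≤ a * r + 0 := by
      rw [hq, add_zero]
      exact mul_le_mul_right h a
    have : y = 0 := le_antisymm (le_of_add_le_add_left h₁) zero_le
    exact this ▸ dvd_zero a

theorem Dec.dvd {f g : M.Num → M.Num} (hf : Comp f) (hg : Comp g) : Dec fun n => f n ∣ g n := by
  refine (Dec.bex (R := fun q n => g n = f n * q)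
    (.eq (hg.comp .right_self) ((hf.comp .right_self).mul .left_self))
    (hg.add (.const 1))).congr fun n => ⟨?_, fun ⟨q, _, hq⟩ => ⟨q, hq⟩⟩
  rintro ⟨q, hq⟩
  -- The quotient is at most `g n` except when dividing by `0`, where the quotient `0` serves.
  rcases eq_zero_or_succ (f n) with h0 | ⟨a, ha⟩
  · exact ⟨0, lt_succ_iff.mpr zero_le, by rw [hq, h0]; simp⟩
  · refine ⟨q, lt_succ_iff.mpr ?_, hq⟩
    rw [hq, ha]
    exact le_mul_of_one_le_left zero_le le_add_self

/-- The `i`-th of the pairwise coprime moduli given by `m`. -/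
def modulus (m i : M.Num) : M.Num := m * (i + 1) + 1

theorem Comp.modulus {f g : M.Num → M.Num} (hf : Comp f) (hg : Comp g) :
    Comp fun n => modulus (f n) (g n) :=
  (hf.mul (hg.add (.const 1))).add (.const 1)

theorem memCode_pair {i k m n : M.Num} :
    MemCode i (pair k (pair m n)) ↔ i < k ∧ modulus m i ∣ n := by
  constructor
  · rintro ⟨k', m', n', h, hi, q, hq⟩
    obtain ⟨rfl, h'⟩ := pair_inj.mp h
    obtain ⟨rfl, rfl⟩ := pair_inj.mp h'
    exact ⟨hi, q, hq⟩
  · rintro ⟨hi, q, hq⟩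
    exact ⟨k, m, n, rfl, hi, q, hq⟩

theorem isTriple_iff {c : M.Num} :
    IsTriple c ↔ c = pair (left c) (pair (left (right c)) (right (right c))) := by
  constructor
  · rintro ⟨k, m, n, rfl⟩
    simp
  · exact fun h => ⟨_, _, _, h⟩

theorem memCode_iff {i c : M.Num} :
    MemCode i c ↔ IsTriple c ∧ i < left c ∧ modulus (left (right c)) i ∣ right (right c) := by
  constructor
  · intro h
    obtain ⟨k, m, n, rfl, _⟩ := id h
    simpa [IsTriple, pair_inj] using memCode_pair.mp h
  · rintro ⟨⟨k, m, n, rfl⟩, h⟩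
    simpa using memCode_pair.mpr (by simpa using h)

theorem Dec.isTriple {f : M.Num → M.Num} (hf : Comp f) : Dec fun n => IsTriple (f n) :=
  (Dec.eq hf (hf.left.pair (hf.right.left.pair hf.right.right))).congr fun _ => isTriple_iff

theorem Dec.memCode {f g : M.Num → M.Num} (hf : Comp f) (hg : Comp g) :
    Dec fun n => MemCode (f n) (g n) :=
  ((Dec.isTriple hg).and ((Dec.lt hf hg.left).and
    (.dvd (hg.right.left.modulus hf) hg.right.right))).congr fun _ => memCode_iff

theorem MemCode.lt {i c : M.Num} (h : MemCode i c) : i < c := by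
  obtain ⟨k, m, n, rfl, hi, _⟩ := h
  exact hi.trans_le (left_le_pair _ _)

/-- Modulo `m * (i + 1) + 1` the number `m` is a unit, with `m * (i + 1)` congruent to `-1`; hence
so is each of its divisors `d`. -/
theorem modulus_dvd_of_dvd_mul_add {m i d z : M.Num} (hd : d ∣ m)
    (h : modulus m i ∣ z * (m * d)) : modulus m i ∣ z := by
  have key : ∀ y, modulus m i ∣ m * y → modulus m i ∣ y := by
    intro y hy
    refine num_dvd_of_dvd_add (x := m * y * (i + 1)) ?_ (hy.mul_right _)
    exact ⟨y, by unfold modulus; ring⟩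
  obtain ⟨e, he⟩ := hd
  have h₁ : modulus m i ∣ z * d := key _ (by rwa [mul_left_comm] at h)
  refine key z ?_
  have h₂ := h₁.mul_right e
  rwa [mul_assoc, ← he, mul_comm] at h₂

/-- Coprimality as a cancellation law: two moduli differ by `m * d`, where `d` is the distance of
`i` and `j`. -/
theorem modulus_dvd_of_dvd_mul {m i j z : M.Num}
    (hd : ∀ d, i + d = j ∨ j + d = i → d ∣ m) (h : modulus m i ∣ z * modulus m j) :
    modulus m i ∣ z := by
  rcases le_total i j with hij | hij
  · obtain ⟨d, rfl⟩ := exists_add_of_le hij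
    refine modulus_dvd_of_dvd_mul_add (hd d (Or.inl rfl)) (num_dvd_of_dvd_add (x := z * modulus m i)
      ?_ (dvd_mul_left _ _))
    have : z * modulus m i + z * (m * d) = z * modulus m (i + d) := by unfold modulus; ring
    rwa [this]
  · obtain ⟨d, rfl⟩ := exists_add_of_le hij
    refine modulus_dvd_of_dvd_mul_add (hd d (Or.inr rfl)) (num_dvd_of_dvd_add (x := z * modulus m j)
      ?_ h)
    exact ⟨z, by unfold modulus; ring⟩

theorem exists_common_multiple_succ (k : M.Num) :
    ∃ m : M.Num, 0 < m ∧ ∀ d, d < k → d + 1 ∣ m := by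
  refine sigma_induction (R := fun m k => 0 < m ∧ ∀ d, d < k → d + 1 ∣ m) ?_ ?_ ?_ k
  · refine (Dec.lt (.const 0) .left_self).and (Dec.ball (R := fun d p => d + 1 ∣ left p) ?_
      .right_self)
    exact .dvd (Comp.left_self.add (.const 1)) Comp.id.right.left
  · exact ⟨1, zero_lt_one, fun d hd => absurd hd zero_le.not_gt⟩
  · rintro k ⟨m, hm, h⟩
    refine ⟨m * (k + 1), mul_pos hm (lt_of_lt_of_le zero_lt_one le_add_self), fun d hd => ?_⟩
    rcases (lt_succ_iff.mp hd).lt_or_eq with hd | rfl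
    · exact (h d hd).mul_right _
    · exact dvd_mul_left _ _

theorem exists_common_multiple_modulus (m k : M.Num) :
    ∃ p : M.Num, 0 < p ∧ ∀ i, i < k → modulus m i ∣ p := by
  refine sigma_induction (R := fun p k => 0 < p ∧ ∀ i, i < k → modulus m i ∣ p) ?_ ?_ ?_ k
  · refine (Dec.lt (.const 0) .left_self).and (Dec.ball (R := fun i p => modulus m i ∣ left p) ?_
      .right_self)
    exact .dvd ((Comp.const m).modulus .left_self) Comp.id.right.left
  · exact ⟨1, zero_lt_one, fun d hd => absurd hd zero_le.not_gt⟩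
  · rintro k ⟨p, hp, h⟩
    refine ⟨p * modulus m k, mul_pos hp (lt_of_lt_of_le zero_lt_one le_add_self), fun i hi => ?_⟩
    rcases (lt_succ_iff.mp hi).lt_or_eq with hi | rfl
    · exact (h i hi).mul_right _
    · exact dvd_mul_left _ _

/-- Gödel's moduli: `m` is a multiple of `1, …, k`, hence of every nonzero distance between indices
below `k`. -/
theorem exists_moduli (k : M.Num) : ∃ m p : M.Num, 0 < p ∧ (∀ i, i < k → modulus m i ∣ p) ∧
    (∀ i, 1 < modulus m i) ∧
    ∀ i j z, i < k → j < k → i ≠ j → modulus m i ∣ z * modulus m j → modulus m i ∣ z := by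
  obtain ⟨m, hm, hdvd⟩ := exists_common_multiple_succ k
  obtain ⟨p, hp, hdp⟩ := exists_common_multiple_modulus m k
  refine ⟨m, p, hp, hdp, fun i => ?_, fun i j z hi hj hij h => modulus_dvd_of_dvd_mul ?_ h⟩
  · exact lt_add_of_pos_left _ (mul_pos hm (lt_of_lt_of_le zero_lt_one le_add_self))
  · intro d hd
    rcases eq_zero_or_succ d with rfl | ⟨d, rfl⟩
    · rcases hd with hd | hd
      · exact absurd (by simpa using hd) hij
      · exact absurd (by simpa using hd.symm) hij
    · refine hdvd d (succ_le_iff.mp ?_)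
      rcases hd with rfl | rfl
      · exact le_add_self.trans hj.le
      · exact le_add_self.trans hi.le

theorem pos_and_lt_of_eq_mul {a b c : M.Num} (ha : 1 < a) (hc : 0 < c) (h : c = a * b) :
    0 < b ∧ b < c := by
  have hb : 0 < b := by
    rw [pos_iff_ne_zero]
    rintro rfl
    simp [h] at hc
  exact ⟨hb, by rw [h]; exact lt_mul_of_one_lt_left hb ha⟩

/-! ### Finite sets, strong bounding and the pigeonhole principle -/

/-- Every bounded set of the model has a code. -/
theorem Dec.exists_memCode_iff {P : M.Num → Prop} (hP : Dec P) {k : M.Num}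
    (hk : ∀ i, P i → i < k) : ∃ c, IsTriple c ∧ ∀ i, MemCode i c ↔ P i := by
  obtain ⟨m, p, hp, hdvd, hgt, hcop⟩ := exists_moduli k
  have hD : Dec fun c => 0 < c ∧ ∀ i, i < k → P i → modulus m i ∣ c :=
    (Dec.lt (.const 0) .id).and (.ball (R := fun i c => P i → modulus m i ∣ c)
      ((hP.comp .left_self).imp (.dvd ((Comp.const m).modulus .left_self) .right_self)) (.const k))
  -- The least positive common multiple of the wanted moduli has no unwanted modulus as a divisor,
  -- as that one could be divided out.
  obtain ⟨c, ⟨hc, hPc⟩, hmin⟩ := hD.exists_least (n := p) ⟨hp, fun i hi _ => hdvd i hi⟩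
  refine ⟨pair k (pair m c), ⟨_, _, _, rfl⟩, fun i => memCode_pair.trans ?_⟩
  refine ⟨fun ⟨hi, hic⟩ => ?_, fun hi => ⟨hk i hi, hPc i (hk i hi) hi⟩⟩
  by_contra hPi
  obtain ⟨b, hb⟩ := hic
  obtain ⟨hb0, hbc⟩ := pos_and_lt_of_eq_mul (hgt i) hc hb
  refine hmin b hbc ⟨hb0, fun j hj hPj => hcop j i b hj hi ?_ ?_⟩
  · rintro rfl
    exact hPi hPj
  · rw [mul_comm, ← hb]
    exact hPc j hj hPj

/-- Below any bound, the existential quantifier of a `Σ⁰₁` class can be bounded uniformly. -/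
theorem sigma_strong_bounding {R : M.Num → M.Num → Prop}
    (hR : Dec fun p => R (left p) (right p)) (k : M.Num) :
    ∃ w, ∀ y, y < k → (∃ a, R a y) → ∃ a, a < w ∧ R a y := by
  obtain ⟨m, p, hp, hdvd, hgt, hcop⟩ := exists_moduli k
  have hD : Dec fun q : M.Num =>
      0 < right q ∧ ∀ y, y < k → modulus m y ∣ right q ∨ ∃ a, a < left q ∧ R a y := by
    refine (Dec.lt (.const 0) .right_self).and (.ball
      (R := fun y q => modulus m y ∣ right q ∨ ∃ a, a < left q ∧ R a y) ?_ (.const k))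
    exact (Dec.dvd ((Comp.const m).modulus .left_self) Comp.id.right.right).or
      (.bex (R := fun a p => R a (left p)) (hR.comp₂ .left_self Comp.id.right.left)
        Comp.id.right.left)
  -- A divisor `modulus m y` of `c` excuses `y` from having a witness below `w`. For the least `c`,
  -- an excused `y` has no witness at all: otherwise `w` could be raised past the witness and the
  -- modulus divided out of `c`.
  obtain ⟨c, ⟨w, hc, hw⟩, hmin⟩ := sigma_exists_least
    (R := fun w c => 0 < c ∧ ∀ y, y < k → modulus m y ∣ c ∨ ∃ a, a < w ∧ R a y) hD (n := p)
    ⟨0, hp, fun i hi => Or.inl (hdvd i hi)⟩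
  refine ⟨w, fun y hy ⟨a, ha⟩ => (hw y hy).resolve_left fun hyc => ?_⟩
  obtain ⟨b, hb⟩ := hyc
  obtain ⟨hb0, hbc⟩ := pos_and_lt_of_eq_mul (hgt y) hc hb
  refine hmin b hbc ⟨max w (a + 1), hb0, fun z hz => ?_⟩
  by_cases hzy : z = y
  · subst hzy
    exact Or.inr ⟨a, lt_max_of_lt_right (lt_succ_iff.mpr le_rfl), ha⟩
  · rcases hw z hz with h | ⟨a', ha', hR'⟩
    · refine Or.inl (hcop z y b hz hy hzy ?_)
      rwa [mul_comm, ← hb]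
    · exact Or.inr ⟨a', lt_max_of_lt_left ha', hR'⟩

/-- The pigeonhole principle: a function that is injective on an unbounded set is unbounded on
it. -/
theorem exists_lt_of_injOn {D : M.Num → Prop} {g : M.Num → M.Num} (hD : Dec D) (hg : Comp g)
    (hub : ∀ n, ∃ m, n < m ∧ D m) (hinj : ∀ m n, m < n → D m → D n → g m ≠ g n) (k : M.Num) :
    ∃ n, D n ∧ k < g n := by
  by_contra! H
  -- If all values on `D` were at most `k`, each would already be taken at an argument below `w`, so
  -- a later element of `D` would repeat one.
  obtain ⟨w, hw⟩ := sigma_strong_bounding (R := fun n y => D n ∧ g n = y)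
    ((hD.comp .left_self).and (.eq (hg.comp .left_self) .right_self)) (k + 1)
  obtain ⟨n, hn, hDn⟩ := hub w
  obtain ⟨a, ha, hDa, hga⟩ := hw (g n) (lt_succ_iff.mpr (H n hDn)) ⟨n, hDn, rfl⟩
  exact hinj a n (ha.trans hn) hDa hDn hga

/-- Supplies the recursive bounds that `exists_code_family` requires. -/
theorem Comp.exists_bound {g : M.Num → M.Num} (hg : Comp g) :
    ∃ w, Comp w ∧ ∀ n i, i < n → g i < w n := by
  have hR : Dec fun p : M.Num => ∀ i, i < L2Structure.right p → g i < L2Structure.left p :=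
    .ball (R := fun i p => g i < L2Structure.left p)
      (.lt (hg.comp .left_self) Comp.id.right.left) .right_self
  have hex : ∀ n, ∃ w, ∀ i, i < n → g i < w := by
    intro n
    obtain ⟨w, hw⟩ := sigma_strong_bounding (R := fun a y => g y = a)
      (.eq (hg.comp .right_self) .left_self) n
    refine ⟨w, fun i hi => ?_⟩
    obtain ⟨a, ha, rfl⟩ := hw i hi ⟨_, rfl⟩
    exact ha
  exact ⟨L2Structure.least fun w n => ∀ i, i < n → g i < w, .least hR hex,
    fun n =>
      (least_spec (R := fun w n => ∀ i, i < n → g i < w) hR (hex n)).1⟩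

/-- The finite sets of a uniformly bounded recursive family have codes given by a function of the
model. -/
theorem exists_code_family {R : M.Num → M.Num → Prop} {w : M.Num → M.Num}
    (hR : Dec fun p => R (left p) (right p)) (hw : Comp w) (hb : ∀ i n, R i n → i < w n) :
    ∃ c, Comp c ∧ ∀ n, IsFinCode (c n) ∧ ∀ i, MemCode i (c n) ↔ R i n := by
  have hD : Dec fun p : M.Num => IsTriple (left p) ∧ ∀ i, MemCode i (left p) ↔ R i (right p) := by
    refine ((Dec.isTriple .left_self).and (Dec.ball
      (R := fun i p => MemCode i (left p) ↔ R i (right p))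
      ((Dec.memCode .left_self Comp.id.right.left).iff (hR.comp₂ .left_self Comp.id.right.right))
      -- Members of a code are smaller than the code and those of the family are below `w n`, so
      -- comparing the two below the sum suffices.
      (Comp.left_self.add (hw.comp .right_self)))).congr fun p => and_congr_right fun _ => ?_
    refine ⟨fun h i _ => h i, fun h i => ⟨fun hi => ?_, fun hi => ?_⟩⟩
    · exact (h i (hi.lt.trans_le le_self_add)).mp hi
    · exact (h i ((hb _ _ hi).trans_le le_add_self)).mpr hi
  have hex : ∀ n, ∃ c, IsTriple c ∧ ∀ i, MemCode i c ↔ R i n := fun n =>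
    (hR.comp₂ .id (.const n)).exists_memCode_iff (hb · n)
  refine ⟨least fun c n => IsTriple c ∧ ∀ i, MemCode i c ↔ R i n, .least hD hex, fun n => ?_⟩
  obtain ⟨⟨h₁, h₂⟩, h₃⟩ := least_spec
    (R := fun c n => IsTriple c ∧ ∀ i, MemCode i c ↔ R i n) hD (hex n)
  exact ⟨⟨h₁, fun d hd hdt h => h₃ d hd ⟨hdt, fun i => (h i).trans (h₂ i)⟩⟩, h₂⟩

end FiniteSets

end L2Structure

namespace L2Structure

section Reversal

variable {M : L2Structure.{u}} [hM : Fact M.ModelsRCA0]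

/-! ### Bad sequences of finite sets and the Noetherian property -/

theorem QuasiOrder.IsCoded.dec_le {Q : M.QuasiOrder} (hQ : Q.IsCoded) :
    Dec fun p => Q.le (left p) (right p) := by
  have : Dec fun p : M.Num => ∃ a b, Q.le a b ∧ p = pair a b := hQ.2
  refine (this.comp (Comp.left_self.pair .right_self)).congr fun p => ⟨fun h => ⟨_, _, h, rfl⟩, ?_⟩
  rintro ⟨a, b, h, hp⟩
  obtain ⟨h₁, h₂⟩ := pair_inj.mp hp
  rwa [h₁, h₂]

/-- If the finite sets `B n = {i | R i n}` satisfy `∃ p ∈ B m, ∀ q ∈ B n, p ≰ q` whenever `m < n`,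
then the upper topology on `Pf♯ Q` is not Noetherian. -/
theorem QuasiOrder.not_isNoetherian_of_bad_family {Q : M.QuasiOrder} (hQ : Q.IsCoded)
    {R : M.Num → M.Num → Prop} {w : M.Num → M.Num} (hR : Dec fun p => R (left p) (right p))
    (hw : Comp w) (hb : ∀ i n, R i n → i < w n) (hmem : ∀ i n, R i n → i ∈ Q.carrier)
    (hbad : ∀ m n, m < n → ∃ p, R p m ∧ ∀ q, R q n → ¬ Q.le p q) :
    ¬ Q.finSharp.upper.IsNoetherian := by
  intro hN
  -- `sg b` codes `{b}`; it also serves to turn the single index `c n` into the value of an open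
  -- code.
  obtain ⟨sg, hsg, hsgm⟩ := exists_code_family (R := fun i b : M.Num => i = b)
    (.eq .left_self .right_self) (Comp.id.add (.const 1))
    fun i n h => lt_succ_iff.mpr (le_of_eq h)
  obtain ⟨W, hW, hWb⟩ := hsg.exists_bound
  -- `c n = {{b} | b ∈ B n}`. Since `A ≤♯ {b}` means that some element of `A` is below `b`, the set
  -- `V_(c n)` consists of the `A` without an element below an element of `B n`.
  obtain ⟨c, hc, hcm⟩ := exists_code_family (R := fun e n => ∃ b, b < w n ∧ R b n ∧ e = sg b)
    (.bex (R := fun b p => R b (right p) ∧ left p = sg b)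
      ((hR.comp₂ .left_self Comp.id.right.right).and
        (.eq Comp.id.right.left (hsg.comp .left_self))) (hw.comp .right_self))
    (hW.comp hw) (by
      rintro _ n ⟨b, hb, -, rfl⟩
      exact hWb _ _ hb)
  obtain ⟨U, hU, hUb⟩ := hw.exists_bound
  -- The point `x k` collects all elements of earlier `B n` that are below nothing in `B k`: it lies
  -- in `V_(c k)`, and `hbad` puts it outside the earlier `V_(c n)`.
  obtain ⟨x, -, hx⟩ := exists_code_family
    (R := fun a k => (∃ n, n < k ∧ R a n) ∧ ∀ b, b < w k → R b k → ¬ Q.le a b)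
    ((Dec.bex (R := fun n p => R (left p) n) (hR.comp₂ Comp.id.right.left .left_self)
      .right_self).and (.ball (R := fun b p => R b (right p) → ¬ Q.le (left p) b)
      ((hR.comp₂ .left_self Comp.id.right.right).imp
        (hQ.dec_le.comp₂ Comp.id.right.left .left_self).not) (hw.comp .right_self)))
    hU (by
      rintro a k ⟨⟨n, hn, ha⟩, -⟩
      exact (hb a n ha).trans (hUb k n hn))
  have hsgQ : ∀ b ∈ Q.carrier, sg b ∈ Pf Q.carrier := fun b hb =>
    ⟨(hsgm b).1, fun i hi => ((hsgm b).2 i).mp hi ▸ hb⟩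
  have hcQ : ∀ n, c n ∈ Pf (Pf Q.carrier) := fun n => ⟨(hcm n).1, fun e he => by
    obtain ⟨b, -, hb, rfl⟩ := ((hcm n).2 e).mp he
    exact hsgQ b (hmem b n hb)⟩
  have hxQ : ∀ k, x k ∈ Pf Q.carrier := fun k => ⟨(hx k).1, fun a ha => by
    obtain ⟨⟨n, -, hn⟩, -⟩ := ((hx k).2 a).mp ha
    exact hmem a n hn⟩
  have hopen : Q.finSharp.upper.IsOpenCode {p | ∃ n, p = pair n (sg (c n))} := by
    refine ⟨hsg.comp hc, ?_, fun n _ => ⟨sg (c n), pair_mem_graph.mpr rfl, fun b hb =>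
      pair_mem_graph (g := fun n => sg (c n)) |>.mp hb⟩⟩
    rintro _ ⟨n, rfl⟩
    refine ⟨n, trivial, _, ⟨(hsgm _).1, fun i hi => ?_⟩, rfl⟩
    obtain rfl := ((hsgm _).2 i).mp hi
    exact hcQ n
  obtain ⟨k, hk⟩ := hN _ hopen _ hopen subset_rfl
  have hxopen : x k ∈ Q.finSharp.upper.openSet {p | ∃ n, p = pair n (sg (c n))} := by
    refine ⟨hxQ k, k, sg (c k), c k, pair_mem_graph.mpr rfl, ((hsgm _).2 _).mpr rfl, hxQ k, ?_⟩
    rintro ⟨e, he, -, -, hle⟩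
    obtain ⟨b, hbw, hb, rfl⟩ := ((hcm k).2 e).mp he
    obtain ⟨a, ha, hab⟩ := hle b (((hsgm b).2 b).mpr rfl)
    exact (((hx k).2 a).mp ha).2 b hbw hb hab
  obtain ⟨-, n, d, i, hnk, hd, hi, -, hni⟩ := hk hxopen
  obtain rfl := pair_mem_graph (g := fun n => sg (c n)) |>.mp hd
  obtain rfl := ((hsgm _).2 i).mp hi
  obtain ⟨p, hp, hpq⟩ := hbad n k hnk
  refine hni ⟨sg p, ((hcm n).2 _).mpr ⟨p, hb p n hp, hp, rfl⟩, hxQ k, hsgQ p (hmem p n hp),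
    fun b hb' => ?_⟩
  obtain rfl := ((hsgm p).2 b).mp hb'
  exact ⟨b, ((hx k).2 b).mpr ⟨⟨n, hnk, hp⟩, fun q _ hq => hpq q hq⟩, Q.refl b (hmem b n hp)⟩

/-! ### The quasi-order of stages -/

/-- The stage `k` is `n`, or it is recognized as false by stage `n`: a value below `f k` is
enumerated after stage `k` and not after stage `n`. -/
def StageLe (f : M.Num → M.Num) (k n : M.Num) : Prop :=
  k = n ∨ ∃ i, i < n + 1 ∧ k < i ∧ f i < f k

/-- The product of the order `StageLe f` with the numbers. -/
def stageOrder (f : M.Num → M.Num) : M.QuasiOrder where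
  carrier := {p | ∃ k x, p = pair k x}
  le p q := (∃ k x, p = pair k x) ∧ (∃ l y, q = pair l y) ∧
    StageLe f (left p) (left q) ∧ right p ≤ right q
  mem_of_le _ _ h := ⟨h.1, h.2.1⟩
  refl p hp := ⟨hp, hp, Or.inl rfl, le_rfl⟩
  trans := by
    rintro p q r ⟨hp, -, hpq, hpq'⟩ ⟨-, hr, hqr, hqr'⟩
    refine ⟨hp, hr, ?_, hpq'.trans hqr'⟩
    rcases hpq with h | ⟨i, hi, hpi, hfi⟩
    · rwa [h]
    · refine Or.inr ⟨i, ?_, hpi, hfi⟩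
      rcases hqr with h | ⟨j, hj, hqj, -⟩
      · rwa [← h]
      -- A strict relation between stages increases the stage, so falsity once recognized stays
      -- recognized.
      · exact hi.trans_le ((succ_le_iff.mpr hqj).trans hj.le)

theorem Dec.stageLe {f : M.Num → M.Num} (hf : Comp f) {g h : M.Num → M.Num} (hg : Comp g)
    (hh : Comp h) : Dec fun n => StageLe f (g n) (h n) :=
  (Dec.eq hg hh).or (.bex (R := fun i n => g n < i ∧ f i < f (g n))
    ((Dec.lt (hg.comp .right_self) .left_self).and
      (.lt (hf.comp .left_self) (hf.comp (hg.comp .right_self)))) (hh.add (.const 1)))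

theorem stageOrder_isCoded {f : M.Num → M.Num} (hf : Comp f) : (stageOrder f).IsCoded := by
  have hle : Dec fun p => (stageOrder f).le (left p) (right p) :=
    (Dec.exists_eq_pair.comp .left_self).and ((Dec.exists_eq_pair.comp .right_self).and
      ((Dec.stageLe hf Comp.id.left.left Comp.id.right.left).and
        (.le Comp.id.left.right Comp.id.right.right)))
  refine ⟨Dec.exists_eq_pair, (Dec.exists_eq_pair.and hle).congr fun p => ⟨?_, ?_⟩⟩
  · rintro ⟨a, b, h, rfl⟩
    exact ⟨⟨_, _, rfl⟩, by simpa using h⟩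
  · rintro ⟨⟨a, b, rfl⟩, h⟩
    exact ⟨a, b, by simpa using h, rfl⟩

/-- The `n`-th member of the bad sequence of finite sets of the order `stageOrder f`: the pairs
`(k, x)` for which `k` appears to be a true stage at stage `n` and `x` is at most every value
enumerated between `k` and `n`. -/
def InStage (f : M.Num → M.Num) (p n : M.Num) : Prop :=
  (∃ k x, p = pair k x) ∧ left p ≤ n ∧ right p ≤ f (left p + 1) + 1 ∧
    ∀ i, i < n + 1 → left p < i → f (left p) ≤ f i ∧ right p ≤ f i

theorem Dec.inStage {f : M.Num → M.Num} (hf : Comp f) :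
    Dec fun p => InStage f (L2Structure.left p) (L2Structure.right p) :=
  (Dec.exists_eq_pair.comp .left_self).and ((Dec.le Comp.id.left.left .right_self).and
    ((Dec.le Comp.id.left.right ((hf.comp (Comp.id.left.left.add (.const 1))).add (.const 1))).and
    (.ball (R := fun i q => L2Structure.left (L2Structure.left q) < i →
        f (L2Structure.left (L2Structure.left q)) ≤ f i ∧
        L2Structure.right (L2Structure.left q) ≤ f i)
      ((Dec.lt Comp.id.right.left.left .left_self).imp
        ((Dec.le (hf.comp Comp.id.right.left.left) (hf.comp .left_self)).and
          (.le Comp.id.right.left.right (hf.comp .left_self))))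
      (Comp.right_self.add (.const 1)))))

theorem inStage_pair {f : M.Num → M.Num} {k x n : M.Num} :
    InStage f (pair k x) n ↔ k ≤ n ∧ x ≤ f (k + 1) + 1 ∧
      ∀ i, i < n + 1 → k < i → f k ≤ f i ∧ x ≤ f i := by
  simp [InStage, pair_inj]

/-- If `k` still looks true at stage `n`, then no `l ≤ n` other than `k` is above it, so only the
second components at `l = k` matter. -/
theorem not_stageOrder_le {f : M.Num → M.Num} {k x l y n : M.Num} (hln : l ≤ n)
    (htrue : ∀ i, i < n + 1 → k < i → f k ≤ f i) (hy : k = l → y < x) :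
    ¬ (stageOrder f).le (pair k x) (pair l y) := by
  rintro ⟨-, -, h, hxy⟩
  simp only [left_pair, right_pair] at h hxy
  rcases h with h | ⟨i, hi, hki, hfi⟩
  · exact (hy h).not_ge hxy
  · exact (htrue i (hi.trans_le (add_le_add_left hln 1)) hki).not_gt hfi

/-- At an apparently true `k`, the second components range up to the minimum of the values
enumerated after `k`, and this cap falls as stages pass. For `k = n` nothing has been enumerated
yet; the cap `f (k + 1) + 1` keeps the set finite and drops strictly at the next stage. If `m` still
looks true at `n`, its own cap has dropped; otherwise the cap has dropped at the last `k < m` that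
still looks true. -/
theorem inStage_bad {f : M.Num → M.Num} (hf : Comp f) (hf0 : f 0 = 0) {m n : M.Num}
    (hmn : m < n) : ∃ p, InStage f p m ∧ ∀ q, InStage f q n → ¬ (stageOrder f).le p q := by
  by_cases hm : ∀ i, i < n + 1 → m < i → f m ≤ f i
  · refine ⟨pair m (f (m + 1) + 1), inStage_pair.mpr ⟨le_rfl, le_rfl, fun i hi hmi => ?_⟩, ?_⟩
    · exact absurd hmi (lt_succ_iff.mp hi).not_gt
    · rintro _ ⟨⟨l, y, rfl⟩, hq⟩
      simp only [left_pair, right_pair] at hq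
      refine not_stageOrder_le hq.1 hm ?_
      rintro rfl
      exact lt_succ_iff.mpr (hq.2.2 (m + 1) (lt_succ_iff.mpr (succ_le_iff.mpr hmn))
        (lt_succ_iff.mpr le_rfl)).2
  · have hD : Dec fun k => k ≤ m ∧ ∀ i, i < n + 1 → k < i → f k ≤ f i :=
      (Dec.le .id (.const m)).and (.ball (R := fun i k => k < i → f k ≤ f i)
        ((Dec.lt .right_self .left_self).imp (.le (hf.comp .right_self) (hf.comp .left_self)))
        (.const _))
    -- Stage `0` always looks true because `f 0 = 0`.
    obtain ⟨k, ⟨hkm, hk⟩, hmax⟩ := hD.exists_greatest (n := 0) (b := m)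
      ⟨zero_le, fun i _ _ => by rw [hf0]; exact zero_le⟩ fun k hk => hk.1
    have hkm' : k < m := lt_of_le_of_ne hkm (by rintro rfl; exact hm hk)
    have hV : Dec fun v => ∃ i, i < m + 1 ∧ k < i ∧ f i = v :=
      .bex (R := fun i v => k < i ∧ f i = v)
        ((Dec.lt (.const k) .left_self).and (.eq (hf.comp .left_self) .right_self)) (.const _)
    -- The minimum of `f` on the stages after `k` up to `m` is the cap of `k` at stage `m`.
    obtain ⟨v, ⟨i₀, hi₀, hki₀, rfl⟩, hv⟩ := hV.exists_least (n := f m)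
      ⟨m, lt_succ_iff.mpr le_rfl, hkm', rfl⟩
    have hv' : ∀ i, i < m + 1 → k < i → f i₀ ≤ f i := fun i hi hki =>
      not_lt.mp fun h => hv _ h ⟨i, hi, hki, rfl⟩
    have hmn' : m + 1 < n + 1 := lt_succ_iff.mpr (succ_le_iff.mpr hmn)
    refine ⟨pair k (f i₀), inStage_pair.mpr ⟨hkm, ?_, fun i hi hki => ⟨?_, hv' i hi hki⟩⟩, ?_⟩
    · exact (hv' (k + 1) (add_lt_add_left hkm' 1) (lt_succ_iff.mpr le_rfl)).trans le_self_add
    · exact hk i (hi.trans hmn') hki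
    · rintro _ ⟨⟨l, y, rfl⟩, hq⟩
      simp only [left_pair, right_pair] at hq
      refine not_stageOrder_le hq.1 hk ?_
      rintro rfl
      -- If the cap had not dropped below `f i₀` by stage `n`, then `i₀` would look true at `n`,
      -- against the maximality of `k`.
      by_contra hy
      refine (hmax i₀ ⟨lt_succ_iff.mp hi₀, fun i hi hii => ?_⟩).not_gt hki₀
      exact (not_lt.mp hy).trans (hq.2.2 i hi (hki₀.trans hii)).2

theorem stageOrder_not_isNoetherian {f : M.Num → M.Num} (hf : Comp f) (hf0 : f 0 = 0) :
    ¬ (stageOrder f).finSharp.upper.IsNoetherian := by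
  obtain ⟨w, hw, hb⟩ := (Comp.id.pair ((hf.comp (Comp.id.add (.const 1))).add
    (.const 1))).exists_bound
  refine QuasiOrder.not_isNoetherian_of_bad_family (stageOrder_isCoded hf) (R := InStage f)
    (Dec.inStage hf) (hw.comp (Comp.id.add (.const 1))) ?_ (fun i n h => h.1)
    fun m n hmn => inStage_bad hf hf0 hmn
  rintro _ n ⟨⟨k, x, rfl⟩, hq⟩
  simp only [left_pair, right_pair] at hq
  exact (pair_le_pair le_rfl hq.2.1).trans_lt (hb (n + 1) k (lt_succ_iff.mpr hq.1))

/-! ### Bad sequences of stages compute the range -/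

/-- If unboundedly many true stages of an injection can be listed, then its range exists. -/
theorem Dec.range_of_true_stages {f l : M.Num → M.Num} {D : M.Num → Prop} (hf : Comp f)
    (hinj : Function.Injective f) (hl : Comp l) (hD : Dec D)
    (htrue : ∀ j, D j → ∀ i, l j < i → f (l j) ≤ f i) (hub : ∀ k, ∃ j, D j ∧ k < l j) :
    Dec fun y => ∃ n, f n = y := by
  refine .of_ex_all (R := fun n y => f n = y)
    -- Nothing below `f (l j)` is enumerated after a true stage `l j`, which gives a Π⁰₁ description
    -- of the range.
    (S := fun j y => D j → y < f (l j) → ∃ i, i < l j + 1 ∧ f i = y)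
    (.eq (hf.comp .left_self) .right_self) ?_ (fun _ => Iff.rfl) fun y => ⟨?_, fun h => ?_⟩
  · exact (hD.comp .left_self).imp ((Dec.lt .right_self (hf.comp (hl.comp .left_self))).imp
      (.bex (R := fun i p => f i = right p) (.eq (hf.comp .left_self) Comp.id.right.right)
        ((hl.comp .left_self).add (.const 1))))
  · rintro ⟨n, rfl⟩ j hj hlt
    refine ⟨n, lt_succ_iff.mpr (not_lt.mp fun h => ?_), rfl⟩
    exact (htrue j hj n h).not_gt hlt
  · obtain ⟨w, hw⟩ := sigma_strong_bounding (R := fun n y => f n = y)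
      (.eq (hf.comp .left_self) .right_self) (y + 1)
    obtain ⟨j, hj, hwj⟩ := hub w
    -- All values up to `y` that occur are taken before `w`, so by injectivity the value at `l j >
    -- w` is larger than `y`.
    have hlt : y < f (l j) := by
      by_contra hle
      obtain ⟨a, ha, hfa⟩ := hw (f (l j)) (lt_succ_iff.mpr (not_lt.mp hle)) ⟨_, rfl⟩
      exact (ha.trans hwj).ne (hinj hfa)
    obtain ⟨i, -, hi⟩ := h j hj hlt
    exact ⟨i, hi⟩

/-- The indices at which `x` exceeds all its earlier values are unbounded. Between two of them `x`
increases, so badness forbids the earlier stage to lie below the later one. -/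
theorem Dec.range_of_bad_unbounded {f l x : M.Num → M.Num} (hf : Comp f)
    (hinj : Function.Injective f) (hl : Comp l) (hx : Comp x)
    (hbad : ∀ m n, m < n → StageLe f (l m) (l n) → x n < x m) (hub : ∀ k, ∃ n, k < x n) :
    Dec fun y => ∃ n, f n = y := by
  have hD : Dec fun j => ∀ i, i < j → x i < x j :=
    .ball (R := fun i j => x i < x j) (.lt (hx.comp .left_self) (hx.comp .right_self)) .id
  have hDub : ∀ n, ∃ m, n < m ∧ ∀ i, i < m → x i < x m := by
    intro n
    obtain ⟨w, -, hw⟩ := hx.exists_bound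
    obtain ⟨m, hm⟩ := hub (w (n + 1))
    obtain ⟨m, hm, hmin⟩ := (Dec.lt (.const (w (n + 1))) hx).exists_least hm
    -- The first index at which `x` exceeds a bound for its values up to `n` is a record after `n`.
    refine ⟨m, not_le.mp fun h => ?_, fun i hi => (not_lt.mp (hmin i hi)).trans_lt hm⟩
    exact (hw (n + 1) m (lt_succ_iff.mpr h)).not_gt hm
  have hlinj : ∀ m n, m < n → (∀ i, i < m → x i < x m) → (∀ i, i < n → x i < x n) →
      l m ≠ l n := fun m n hmn _ hn he => (hbad m n hmn (Or.inl he)).not_gt (hn m hmn)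
  refine .range_of_true_stages hf hinj hl hD (fun m hm s hs => not_lt.mp fun hfs => ?_)
    (exists_lt_of_injOn hD hl hDub hlinj)
  -- The stages at records are distinct, hence some later record has a stage past `s`, where the
  -- falsity of `l m` is seen.
  obtain ⟨n, ⟨hn, hmn⟩, hsn⟩ := exists_lt_of_injOn (hD.and (.lt (.const m) .id)) hl
    (fun n => by
      obtain ⟨k, hk, hkD⟩ := hDub (max m n)
      exact ⟨k, (le_max_right _ _).trans_lt hk, hkD, (le_max_left _ _).trans_lt hk⟩)
    (fun i j hij hi hj => hlinj i j hij hi.1 hj.1) s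
  exact (hbad m n hmn (Or.inr ⟨s, lt_succ_iff.mpr hsn.le, hs, hfs⟩)).not_gt (hn m hmn)

/-- The pairs `(l n, x n)` are distinct, so bounded `x` makes `l` unbounded. Take a false stage with
the least second component: every later term whose stage has recognized it has a smaller second
component, hence a true stage. -/
theorem Dec.range_of_bad_bounded {f l x : M.Num → M.Num} (hf : Comp f)
    (hinj : Function.Injective f) (hl : Comp l) (hx : Comp x)
    (hbad : ∀ m n, m < n → StageLe f (l m) (l n) → x n < x m) {b : M.Num} (hb : ∀ n, x n ≤ b) :
    Dec fun y => ∃ n, f n = y := by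
  have hlub : ∀ m k, ∃ n, m < n ∧ k < l n := by
    intro m k
    obtain ⟨n, hmn, hn⟩ := exists_lt_of_injOn (g := fun n => L2Structure.pair (l n) (x n))
      (Dec.lt (.const m) .id) (hl.pair hx)
      (fun n => ⟨max m n + 1, lt_succ_iff.mpr (le_max_right _ _),
        lt_succ_iff.mpr (le_max_left _ _)⟩)
      (fun i j hij _ _ he => by
        obtain ⟨h₁, h₂⟩ := pair_inj.mp he
        exact (hbad i j hij (Or.inl h₁)).ne' h₂)
      (L2Structure.pair k b)
    exact ⟨n, hmn, not_le.mp fun h => (pair_le_pair h (hb n)).not_gt hn⟩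
  have hR : Dec fun p : M.Num => x (left (left p)) = right p ∧
      l (left (left p)) < right (left p) ∧ f (right (left p)) < f (l (left (left p))) :=
    (Dec.eq (hx.comp Comp.id.left.left) .right_self).and
      ((Dec.lt (hl.comp Comp.id.left.left) Comp.id.left.right).and
        (.lt (hf.comp Comp.id.left.right) (hf.comp (hl.comp Comp.id.left.left))))
  by_cases hfalse : ∃ n s, l n < s ∧ f s < f (l n)
  · obtain ⟨n, s, hs, hfs⟩ := hfalse
    -- The witness `a` pairs the index of a term with a stage that refutes the truth of the stage of
    -- that term.
    obtain ⟨c, ⟨a, rfl, hs, hfs⟩, hmin⟩ := sigma_exists_least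
      (R := fun a c => x (left a) = c ∧ l (left a) < right a ∧ f (right a) < f (l (left a))) hR
      (n := x n) ⟨L2Structure.pair n s, by simpa using ⟨hs, hfs⟩⟩
    refine .range_of_true_stages (D := fun j => left a < j ∧ right a < l j) hf hinj hl
      ((Dec.lt (.const _) .id).and (.lt (.const _) hl)) ?_ fun k => ?_
    · rintro j ⟨haj, hj⟩ i hi
      by_contra hfi
      refine hmin (x j) (hbad _ _ haj (Or.inr ⟨_, lt_succ_iff.mpr hj.le, hs, hfs⟩))
        ⟨L2Structure.pair j i, ?_⟩
      simpa using ⟨hi, not_le.mp hfi⟩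
    · obtain ⟨n, hn, hkn⟩ := hlub (left a) (max (right a) k)
      exact ⟨n, ⟨hn, (le_max_left _ _).trans_lt hkn⟩, (le_max_right _ _).trans_lt hkn⟩
  · push Not at hfalse
    refine .range_of_true_stages (D := fun j => 0 < j) hf hinj hl (.lt (.const _) .id)
      (fun j _ => hfalse j) fun k => hlub 0 k

theorem Dec.range_of_not_isWQO {f : M.Num → M.Num} (hf : Comp f) (hinj : Function.Injective f)
    (h : ¬ (stageOrder f).IsWQO) : Dec fun y => ∃ n, f n = y := by
  simp only [QuasiOrder.IsWQO, not_forall] at h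
  obtain ⟨F, hF, ⟨hFp, hFu⟩, hbad⟩ := h
  choose g hg hgu using fun n => hFu n trivial
  have hFg : {p | ∃ n, p = L2Structure.pair n (g n)} = F := by
    ext p
    constructor
    · rintro ⟨n, rfl⟩
      exact hg n
    · intro hp
      obtain ⟨n, -, y, -, rfl⟩ := hFp p hp
      exact ⟨n, by rw [hgu n y hp]⟩
  have hgC : Comp g := by
    rw [Comp, hFg]
    exact hF
  have hgp : ∀ n, ∃ k x, g n = L2Structure.pair k x := by
    intro n
    obtain ⟨m, -, y, hy, he⟩ := hFp _ (hg n)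
    rw [(pair_inj.mp he).2]
    exact hy
  have hbad' : ∀ m n, m < n → StageLe f (left (g m)) (left (g n)) →
      right (g n) < right (g m) := fun m n hmn hle => not_le.mp fun hx =>
    hbad ⟨m, n, g m, g n, hmn, hg m, hg n, hgp m, hgp n, hle, hx⟩
  by_cases hub : ∀ k, ∃ n, k < right (g n)
  · exact .range_of_bad_unbounded hf hinj hgC.left hgC.right hbad' hub
  · push Not at hub
    obtain ⟨b, hb⟩ := hub
    exact .range_of_bad_bounded hf hinj hgC.left hgC.right hbad' hb

end Reversal

end L2Structure

namespace L2Structure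

section Comprehension

variable {M : L2Structure.{u}} [hM : Fact M.ModelsRCA0]

/-! ### From ranges of injections to arithmetical comprehension -/

theorem pair_ne_zero {a b : M.Num} (hb : b ≠ 0) : pair a b ≠ 0 := fun h =>
  hb (le_antisymm (h ▸ right_le_pair a b) zero_le)

/-- Every `Σ⁰₁` class is enumerated, up to a pairing, by an injection. -/
theorem exists_injective_enumeration {R : M.Num → M.Num → Prop}
    (hR : Dec fun p => R (left p) (right p)) : ∃ f : M.Num → M.Num, Comp f ∧
      Function.Injective f ∧ f 0 = 0 ∧ ∀ y, (∃ n, f n = pair y 1) ↔ ∃ a, R a y := by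
  -- `E` selects the pairs `(a, y)` in which `a` is the least witness for `y`, so that each `y` is
  -- enumerated once.
  let E : M.Num → Prop := fun m =>
    (∃ a b, m = pair a b) ∧ R (left m) (right m) ∧ ∀ b, b < left m → ¬ R b (right m)
  have hE : Dec E := Dec.exists_eq_pair.and (hR.and (.ball (R := fun b m => ¬ R b (right m))
    (hR.comp₂ .left_self Comp.id.right.right).not .left_self))
  -- The tag `1` marks enumerated elements and the tag `1 + 1` marks fillers that keep the function
  -- total and injective. The shift by one frees argument `0` for the value `0`, which no tagged
  -- pair equals.
  let G : M.Num → M.Num → Prop := fun y n => (n = 0 ∧ y = 0) ∨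
    ∃ m, m < n ∧ n = m + 1 ∧ ((E m ∧ y = pair (right m) 1) ∨ (¬ E m ∧ y = pair m (1 + 1)))
  have hG : Dec fun p => G (left p) (right p) := by
    refine ((Dec.eq .right_self (.const 0)).and (.eq .left_self (.const 0))).or
      (.bex (R := fun m p => right p = m + 1 ∧ ((E m ∧ left p = pair (right m) 1) ∨
        (¬ E m ∧ left p = pair m (1 + 1)))) ?_ .right_self)
    exact (Dec.eq Comp.id.right.right (Comp.left_self.add (.const 1))).and
      (((hE.comp .left_self).and (.eq Comp.id.right.left (Comp.id.left.right.pair (.const 1)))).or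
      ((hE.comp .left_self).not.and (.eq Comp.id.right.left (Comp.left_self.pair (.const _)))))
  have hex : ∀ n, ∃ y, G y n := by
    intro n
    rcases eq_zero_or_succ n with rfl | ⟨m, rfl⟩
    · exact ⟨0, Or.inl ⟨rfl, rfl⟩⟩
    · by_cases hm : E m
      · exact ⟨_, Or.inr ⟨m, lt_succ_iff.mpr le_rfl, rfl, Or.inl ⟨hm, rfl⟩⟩⟩
      · exact ⟨_, Or.inr ⟨m, lt_succ_iff.mpr le_rfl, rfl, Or.inr ⟨hm, rfl⟩⟩⟩
  have hf : ∀ n, G (least G n) n := fun n => (least_spec hG (hex n)).1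
  have h1 : (1 : M.Num) ≠ 0 := one_ne_zero
  have h2 : (1 + 1 : M.Num) ≠ 0 := (lt_of_lt_of_le zero_lt_one le_add_self).ne'
  have h12 : (1 : M.Num) ≠ 1 + 1 := (lt_succ_iff.mpr le_rfl).ne
  have hsucc : ∀ m : M.Num, m + 1 ≠ 0 := fun m => (lt_of_lt_of_le zero_lt_one le_add_self).ne'
  have hEinj : ∀ m m', E m → E m' → right m = right m' → m = m' := by
    rintro _ _ ⟨⟨a, y, rfl⟩, ha, hmin⟩ ⟨⟨b, z, rfl⟩, hb, hmin'⟩ he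
    simp only [left_pair, right_pair] at *
    subst he
    rw [pair_inj]
    exact ⟨le_antisymm (not_lt.mp fun h => hmin _ h hb) (not_lt.mp fun h => hmin' _ h ha), rfl⟩
  refine ⟨least G, .least hG hex, fun n n' he => ?_, ?_, fun y => ⟨?_, ?_⟩⟩
  · have hn := hf n
    have hn' := hf n'
    rw [he] at hn
    rcases hn with ⟨rfl, hy⟩ | ⟨m, -, rfl, ⟨hm, hy⟩ | ⟨hm, hy⟩⟩ <;>
    rcases hn' with ⟨rfl, hy'⟩ | ⟨m', -, rfl, ⟨hm', hy'⟩ | ⟨hm', hy'⟩⟩ <;>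
    rw [hy] at hy'
    · exact absurd hy'.symm (pair_ne_zero h1)
    · exact absurd hy'.symm (pair_ne_zero h2)
    · exact absurd hy' (pair_ne_zero h1)
    · rw [hEinj m m' hm hm' (pair_inj.mp hy').1]
    · exact absurd (pair_inj.mp hy').2 h12
    · exact absurd hy' (pair_ne_zero h2)
    · exact absurd (pair_inj.mp hy').2.symm h12
    · rw [(pair_inj.mp hy').1]
  · rcases hf 0 with ⟨-, h⟩ | ⟨m, -, h, -⟩
    · exact h
    · exact absurd h.symm (hsucc m)
  · rintro ⟨n, hn⟩
    have := hf n
    rw [hn] at this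
    rcases this with ⟨-, h⟩ | ⟨m, -, -, ⟨hm, h⟩ | ⟨-, h⟩⟩
    · exact absurd h (pair_ne_zero h1)
    · rw [(pair_inj.mp h).1]
      exact ⟨_, hm.2.1⟩
    · exact absurd (pair_inj.mp h).2 h12
  · rintro ⟨a, ha⟩
    obtain ⟨a, ha, hmin⟩ := (hR.comp₂ .id (.const y)).exists_least ha
    have hEa : E (pair a y) := ⟨⟨_, _, rfl⟩, by simpa using ha, by simpa using hmin⟩
    refine ⟨pair a y + 1, ?_⟩
    rcases hf (pair a y + 1) with ⟨h, -⟩ | ⟨m, -, hm, h⟩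
    · exact absurd h (hsucc _)
    · obtain rfl := add_right_cancel hm
      rcases h with ⟨-, h⟩ | ⟨h, -⟩
      · simpa using h
      · exact absurd hEa h

theorem Comp.termVal {g : ℕ → M.Num → M.Num} (hg : ∀ k, Comp (g k)) (t : ArithTerm) :
    Comp fun n => M.termVal (fun k => g k n) t := by
  induction t with
  | var k => exact hg k
  | zero => exact .const 0
  | one => exact .const 1
  | add s t hs ht => exact hs.add ht
  | mul s t hs ht => exact hs.mul ht

theorem Comp.push {g : ℕ → M.Num → M.Num} (hg : ∀ k, Comp (g k)) (k : ℕ) :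
    Comp fun p => M.push (L2Structure.left p) (fun j => g j (L2Structure.right p)) k := by
  cases k with
  | zero => exact .left_self
  | succ k => exact (hg k).comp .right_self

/-- If projections of sets of the model exist, then so do all arithmetically definable sets. -/
theorem Dec.sat (hproj : ∀ R : M.Num → M.Num → Prop,
      (Dec fun p => R (left p) (right p)) → Dec fun y => ∃ a, R a y)
    (V : ℕ → M.sets) (φ : ArithFormula) {g : ℕ → M.Num → M.Num} (hg : ∀ k, Comp (g k)) :
    Dec fun n => M.Sat V (fun k => g k n) φ := by
  induction φ generalizing g with
  | eq s t => exact .eq (.termVal hg s) (.termVal hg t)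
  | lt s t => exact .lt (.termVal hg s) (.termVal hg t)
  | mem t k =>
    exact Dec.comp (P := fun n => n ∈ (V k : Set M.Num)) (V k).2 (.termVal hg t)
  | neg φ ih => exact (ih hg).not
  | and φ ψ ih₁ ih₂ => exact (ih₁ hg).and (ih₂ hg)
  | or φ ψ ih₁ ih₂ => exact (ih₁ hg).or (ih₂ hg)
  | imp φ ψ ih₁ ih₂ => exact (ih₁ hg).imp (ih₂ hg)
  | ball t φ ih =>
    exact .ball (R := fun a n => M.Sat V (M.push a fun k => g k n) φ) (ih (.push hg))
      (.termVal hg t)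
  | bex t φ ih =>
    exact .bex (R := fun a n => M.Sat V (M.push a fun k => g k n) φ) (ih (.push hg))
      (.termVal hg t)
  | all φ ih =>
    -- A universal quantifier is the complement of a projection.
    exact (hproj (fun a n => ¬ M.Sat V (M.push a fun k => g k n) φ) (ih (.push hg)).not).not.congr
      fun n => by simp [Sat]
  | ex φ ih =>
    exact hproj (fun a n => M.Sat V (M.push a fun k => g k n) φ) (ih (.push hg))

theorem modelsACA0_of_projections (hproj : ∀ R : M.Num → M.Num → Prop,
      (Dec fun p => R (left p) (right p)) → Dec fun y => ∃ a, R a y) : M.ModelsACA0 where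
  basic := hM.out.basic
  induction_axiom X hX h0 hs := Dec.induction (P := fun n => n ∈ X) hX h0 hs
  arithmetical_comprehension φ V v := by
    refine ⟨_, Dec.sat hproj V φ (g := fun k n => M.push n v k) fun k => ?_, fun n => Iff.rfl⟩
    cases k with
    | zero => exact .id
    | succ k => exact .const _

end Comprehension

end L2Structure

theorem theorem4p5 (M : L2Structure.{u}) (hRCA : M.ModelsRCA0)
    (hSharp : ∀ Q : M.QuasiOrder, Q.IsCoded → Q.IsWQO → Q.finSharp.upper.IsNoetherian) :
    M.ModelsACA0 := by
  have : Fact M.ModelsRCA0 := ⟨hRCA⟩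
  refine L2Structure.modelsACA0_of_projections fun R hR => ?_
  obtain ⟨f, hf, hinj, hf0, hfR⟩ := L2Structure.exists_injective_enumeration hR
  have hrange : L2Structure.Dec fun y : M.Num => ∃ n, f n = y :=
    .range_of_not_isWQO hf hinj fun hwqo => L2Structure.stageOrder_not_isNoetherian hf hf0
      (hSharp _ (L2Structure.stageOrder_isCoded hf) hwqo)
  exact (hrange.comp (L2Structure.Comp.id.pair (.const 1))).congr fun y => (hfR y).symm
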